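/- Let $q\in(-1,1)\setminus\{0\}$ and let $C(SU_q(2))$ be the universal unital C*-algebra generated by two elements $\alpha,\gamma$ subject to $$\alpha^*\alpha+\gamma^*\gamma=1,\quad \alpha\alpha^*+q^2\gamma^*\gamma=1,\quad \alpha\gamma=q\gamma\alpha,\quad \gamma^*\gamma=\gamma\gamma^*.$$ Let $\Delta$ be its comultiplication, i.e. the unital *-homomorphism with $\Delta(\alpha)=\alpha\otimes\alpha-q\gamma^*\otimes\gamma$ and $\Delta(\gamma)=\gamma\otimes\alpha+\alpha^*\otimes\gamma$, and let $h$ be the Haar state, i.e. the state on $C(SU_q(2))$ with $(h\otimes\mathrm{id})\Delta(a)=h(a)1=(\mathrm{id}\otimes h)\Delta(a)$ for all $a$ (equivalently, for all $a$ in the dense *-subalgebra generated by $\alpha$ and $\gamma$). Let $\pi_h\colon C(SU_q(2))\to B(H_h)$ be the GNS representation of $h$, and let $L^\infty(SU_q(2))\subset B(H_h)$ be the closure of $\pi_h(C(SU_q(2)))$ in the strong operator topology. Let $\pi_h(\gamma)=\mathrm{Phase}(\pi_h(\gamma))\,|\pi_h(\gamma)|$ be the polar decomposition, where $\mathrm{Phase}(\pi_h(\gamma))$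 is the partial isometry with the same kernel as $\pi_h(\gamma)$. Let $f$ be the function with $f(0)=1$ and $f(q^{2n})=(\operatorname{sgn}q)^n$ for $n=0,1,2,\dots$, let $f(\pi_h(\gamma^*\gamma))$ be defined by the Borel functional calculus, and put $$u=f(\pi_h(\gamma^*\gamma))\,\mathrm{Phase}(\pi_h(\gamma)).$$ Then $L^\infty(SU_q(2))$ is a von Neumann algebra, and its center $\{T\in L^\infty(SU_q(2)) : ST=TS\text{ for all }S\in L^\infty(SU_q(2))\}$ is the von Neumann algebra generated by $u$. -/

import Mathlib

open scoped ENNReal TensorProduct InnerProductSpace ComplexOrder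

noncomputable section

namespace SUq

/-! ### The universal C*-algebra `C(SU_q(2))` -/

/-- The defining relations of the quantum group `SU_q(2)` for a pair of elements of a
complex *-algebra. -/
structure Relations {B : Type*} [Ring B] [StarRing B] [Algebra ℂ B] (q : ℝ) (a g : B) : Prop where
  star_a_mul_a : star a * a + star g * g = 1
  a_mul_star_a : a * star a + (q : ℂ) ^ 2 • (star g * g) = 1
  a_mul_g : a * g = (q : ℂ) • (g * a)
  normal_g : star g * g = g * star g

/-- A representation of the relations of `SU_q(2)`: a (nonzero) complex Hilbert space with a pair of
bounded operators on it satisfying the relations. -/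
structure Rep (q : ℝ) : Type 1 where
  /-- the carrier Hilbert space -/
  H : Type
  [normed : NormedAddCommGroup H]
  [inner : InnerProductSpace ℂ H]
  [complete : CompleteSpace H]
  [nontrivial : Nontrivial H]
  /-- the image of `α` -/
  a : H →L[ℂ] H
  /-- the image of `γ` -/
  g : H →L[ℂ] H
  rel : Relations q a g

attribute [instance] Rep.normed Rep.inner Rep.complete Rep.nontrivial

theorem Relations.norm_a_le {q : ℝ} {H : Type*} [NormedAddCommGroup H] [InnerProductSpace ℂ H]
    [CompleteSpace H] {a g : H →L[ℂ] H} (h : Relations q a g) : ‖a‖ ≤ 1 ∧ ‖g‖ ≤ 1 := by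
  have key : ∀ x : H, ‖a x‖ ^ 2 + ‖g x‖ ^ 2 = ‖x‖ ^ 2 := by
    intro x
    have h1 := congrArg (fun T : H →L[ℂ] H => RCLike.re ⟪T x, x⟫_ℂ) h.star_a_mul_a
    simp only [add_apply, inner_add_left, map_add,
      mul_apply_eq_comp, ContinuousLinearMap.star_eq_adjoint,
      ContinuousLinearMap.adjoint_inner_left, one_apply_eq_self,
      inner_self_eq_norm_sq] at h1
    exact h1
  constructor <;> refine ContinuousLinearMap.opNorm_le_bound _ zero_le_one fun x => ?_
  · rw [one_mul]
    exact le_of_sq_le_sq (by nlinarith [key x, sq_nonneg ‖g x‖]) (norm_nonneg x)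
  · rw [one_mul]
    exact le_of_sq_le_sq (by nlinarith [key x, sq_nonneg ‖a x‖]) (norm_nonneg x)

/-- The C*-algebra of all uniformly bounded families of operators, indexed by all representations
of the relations. -/
abbrev BigProd (q : ℝ) : Type 1 := lp (fun r : Rep q => r.H →L[ℂ] r.H) ∞

instance (q : ℝ) : CStarAlgebra (BigProd q) where

/-- The family of the operators `α`, in all representations. -/
def bigA (q : ℝ) : BigProd q :=
  ⟨fun r => r.a, memℓp_infty ⟨1, by rintro _ ⟨r, rfl⟩; exact r.rel.norm_a_le.1⟩⟩

/-- The family of the operators `γ`, in all representations. -/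
def bigG (q : ℝ) : BigProd q :=
  ⟨fun r => r.g, memℓp_infty ⟨1, by rintro _ ⟨r, rfl⟩; exact r.rel.norm_a_le.2⟩⟩

/-- The C*-subalgebra of the product generated by the two families; the norm of a *-polynomial in
the generators is thus the supremum of its norms over all representations of the relations. -/
def univSubalgebra (q : ℝ) : StarSubalgebra ℂ (BigProd q) :=
  (StarAlgebra.adjoin ℂ {bigA q, bigG q}).topologicalClosure

/-- `C(SU_q(2))`: the universal unital C*-algebra generated by two elements `α`, `γ` subject to the
relations of `SU_q(2)`. -/
def CSUq (q : ℝ) : Type 1 := univSubalgebra q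

/-- The C*-algebra structure of `C(SU_q(2))`, inherited from the product. -/
def cstarAlgebraCSUq (q : ℝ) : CStarAlgebra (CSUq q) :=
  StarSubalgebra.cstarAlgebra (univSubalgebra q)
    (h_closed := StarSubalgebra.isClosed_topologicalClosure _)

instance (q : ℝ) : CStarAlgebra (CSUq q) := cstarAlgebraCSUq q

/-- The order of the C*-algebra `C(SU_q(2))`: `a ≤ b` when `b - a` is positive. -/
instance (q : ℝ) : PartialOrder (CSUq q) := CStarAlgebra.spectralOrder (CSUq q)

instance (q : ℝ) : StarOrderedRing (CSUq q) := CStarAlgebra.spectralOrderedRing (CSUq q)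

/-- The generator `α` of `C(SU_q(2))`. -/
def alpha (q : ℝ) : CSUq q :=
  ⟨bigA q, StarSubalgebra.le_topologicalClosure _
    (StarAlgebra.subset_adjoin ℂ _ (Set.mem_insert _ _))⟩

/-- The generator `γ` of `C(SU_q(2))`. -/
def gamma (q : ℝ) : CSUq q :=
  ⟨bigG q, StarSubalgebra.le_topologicalClosure _
    (StarAlgebra.subset_adjoin ℂ _ (Set.mem_insert_of_mem _ rfl))⟩

/-- Universality: every pair of bounded operators satisfying the relations is the image of `(α, γ)`
under a unique unital *-representation of `C(SU_q(2))`. -/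
theorem existsUnique_representation {q : ℝ} {H : Type} [NormedAddCommGroup H]
    [InnerProductSpace ℂ H] [CompleteSpace H] [Nontrivial H] {a g : H →L[ℂ] H}
    (hr : Relations q a g) :
    ∃! ρ : CSUq q →⋆ₐ[ℂ] (H →L[ℂ] H), ρ (alpha q) = a ∧ ρ (gamma q) = g := by
  let r : Rep q := { H := H, a := a, g := g, rel := hr }
  let ρ : CSUq q →⋆ₐ[ℂ] (H →L[ℂ] H) :=
    { toFun := fun x => (x.1 : BigProd q) r
      map_one' := rfl
      map_mul' := fun _ _ => rfl
      map_zero' := rfl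
      map_add' := fun _ _ => rfl
      commutes' := fun _ => rfl
      map_star' := fun _ => rfl }
  refine ⟨ρ, ⟨rfl, rfl⟩, ?_⟩
  rintro σ ⟨h1, h2⟩
  let S : StarSubalgebra ℂ (BigProd q) := StarAlgebra.adjoin ℂ {bigA q, bigG q}
  have hS : ∀ (x : BigProd q) (hx : x ∈ S),
      σ (⟨x, StarSubalgebra.le_topologicalClosure _ hx⟩ : univSubalgebra q)
        = ρ (⟨x, StarSubalgebra.le_topologicalClosure _ hx⟩ : univSubalgebra q) := by
    intro x hx
    induction hx using StarAlgebra.adjoin_induction with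
    | mem x hx =>
      rcases hx with rfl | rfl
      · exact h1
      · exact h2
    | algebraMap c => exact (AlgHomClass.commutes σ c).trans (AlgHomClass.commutes ρ c).symm
    | add x y hx hy h3 h4 =>
      exact (map_add σ _ _).trans ((congrArg₂ (· + ·) h3 h4).trans (map_add ρ _ _).symm)
    | mul x y hx hy h3 h4 =>
      exact (map_mul σ _ _).trans ((congrArg₂ (· * ·) h3 h4).trans (map_mul ρ _ _).symm)
    | star x hx h3 =>
      let X : CSUq q := ⟨x, StarSubalgebra.le_topologicalClosure _ hx⟩
      have h4 : σ X = ρ X := h3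
      have h5 : σ (star X) = ρ (star X) := by rw [map_star, map_star, h4]
      exact h5
  have hcont : ∀ τ : CSUq q →⋆ₐ[ℂ] (H →L[ℂ] H), Continuous τ := fun τ => map_continuous τ
  have hc : IsClosed {x : CSUq q | σ x = ρ x} := isClosed_eq (hcont σ) (hcont ρ)
  ext1 x
  obtain ⟨y, hy⟩ := x
  obtain ⟨u, hu, hlim⟩ := mem_closure_iff_seq_limit.1 hy
  have hlim' : Filter.Tendsto
      (fun n => (⟨u n, StarSubalgebra.le_topologicalClosure _ (hu n)⟩ : univSubalgebra q))
      Filter.atTop (nhds (⟨y, hy⟩ : univSubalgebra q)) := tendsto_subtype_rng.2 hlim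
  exact hc.mem_of_tendsto hlim' (Filter.Eventually.of_forall fun n => hS _ (hu n))

/-! ### The comultiplication and the Haar state -/

/-- The graph `{(a, Δ a)}` of the comultiplication `Δ` of the Hopf *-algebra `Pol(SU_q(2))`, i.e.
of the *-subalgebra of `C(SU_q(2))` generated by `α` and `γ`. As `Δ` is the unital *-homomorphism
with `Δ α = α ⊗ α - q γ* ⊗ γ` and `Δ γ = γ ⊗ α + α* ⊗ γ`, its graph is the unital *-subalgebra
generated by `(α, Δ α)` and `(γ, Δ γ)`. -/
def comulGraph (q : ℝ) : StarSubalgebra ℂ (CSUq q × (CSUq q ⊗[ℂ] CSUq q)) :=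
  StarAlgebra.adjoin ℂ
    {(alpha q, alpha q ⊗ₜ[ℂ] alpha q - (q : ℂ) • (star (gamma q) ⊗ₜ[ℂ] gamma q)),
     (gamma q, gamma q ⊗ₜ[ℂ] alpha q + star (alpha q) ⊗ₜ[ℂ] gamma q)}

/-- The slice map `h ⊗ id`. -/
def sliceLeft {A : Type*} [Ring A] [Algebra ℂ A] (h : A →ₗ[ℂ] ℂ) : A ⊗[ℂ] A →ₗ[ℂ] A :=
  (TensorProduct.lid ℂ A).toLinearMap ∘ₗ h.rTensor A

/-- The slice map `id ⊗ h`. -/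
def sliceRight {A : Type*} [Ring A] [Algebra ℂ A] (h : A →ₗ[ℂ] ℂ) : A ⊗[ℂ] A →ₗ[ℂ] A :=
  (TensorProduct.rid ℂ A).toLinearMap ∘ₗ h.lTensor A

/-- A positive functional `h` on `C(SU_q(2))` is the Haar state if it is a state with
`(h ⊗ id)(Δ a) = h(a) 1 = (id ⊗ h)(Δ a)`; by continuity it is enough to ask for this on the dense
*-subalgebra `Pol(SU_q(2))`. -/
structure IsHaarState {q : ℝ} (h : CSUq q →ₚ[ℂ] ℂ) : Prop where
  map_one : h 1 = 1
  left_invariant : ∀ p ∈ comulGraph q, sliceLeft h.toLinearMap p.2 = h p.1 • (1 : CSUq q)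
  right_invariant : ∀ p ∈ comulGraph q, sliceRight h.toLinearMap p.2 = h p.1 • (1 : CSUq q)

/-! ### Operators on a Hilbert space -/

section Operators

variable {H : Type*} [NormedAddCommGroup H] [InnerProductSpace ℂ H] [CompleteSpace H]

/-- The closure of a set of bounded operators in the strong operator topology. -/
def strongClosure (S : Set (H →L[ℂ] H)) : Set (H →L[ℂ] H) :=
  {T | T.toPointwiseConvergenceCLM ℂ (RingHom.id ℂ) H H ∈
    closure ((fun A : H →L[ℂ] H => A.toPointwiseConvergenceCLM ℂ (RingHom.id ℂ) H H) '' S)}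

/-- The von Neumann algebra generated by a set of operators: the bicommutant of the set and its
adjoints. -/
def vN (S : Set (H →L[ℂ] H)) : VonNeumannAlgebra H where
  toStarSubalgebra := StarSubalgebra.centralizer ℂ
    (StarSubalgebra.centralizer ℂ S : Set (H →L[ℂ] H))
  centralizer_centralizer' := by
    simp

theorem subset_vN (S : Set (H →L[ℂ] H)) : S ⊆ vN S := fun _ hx =>
  StarAlgebra.adjoin_le_centralizer_centralizer ℂ S (StarAlgebra.subset_adjoin ℂ S hx)

theorem vN_le {S : Set (H →L[ℂ] H)} {M : VonNeumannAlgebra H} (h : S ⊆ M) : vN S ≤ M := by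
  intro x hx
  have h2 : S ∪ star S ⊆ (M : Set (H →L[ℂ] H)) := by
    rintro y (hy | hy)
    · exact h hy
    · simpa using star_mem (h hy)
  have h3 : x ∈ (S ∪ star S).centralizer.centralizer := by
    rw [← StarSubalgebra.coe_centralizer_centralizer ℂ]
    exact hx
  have h4 := Set.centralizer_subset (Set.centralizer_subset h2) h3
  rwa [M.centralizer_centralizer] at h4

/-- `V` is the partial isometry `Phase T` of the polar decomposition `T = (Phase T) |T|`. -/
structure IsPhase (T V : H →L[ℂ] H) : Prop where
  isometry_on_initial : V * star V * V = V
  mul_abs : T = V * CFC.abs T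
  ker_eq : V.ker = T.ker

/-- The partial isometry of the polar decomposition is unique. -/
theorem IsPhase.unique {T V W : H →L[ℂ] H} (hV : IsPhase T V) (hW : IsPhase T W) : V = W := by
  have hker : ∀ x, CFC.abs T x = 0 → T x = 0 := fun x hx => by
    rw [hV.mul_abs]
    exact (congrArg V hx).trans (map_zero V)
  let K : Submodule ℂ H := (CFC.abs T).range
  have hrange : ∀ x ∈ K.topologicalClosure, V x = W x := by
    have hc : IsClosed {x | V x = W x} := isClosed_eq V.continuous W.continuous
    refine fun x hx => closure_minimal ?_ hc hx
    rintro _ ⟨y, rfl⟩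
    exact (DFunLike.congr_fun hV.mul_abs y).symm.trans (DFunLike.congr_fun hW.mul_abs y)
  have horth : ∀ x ∈ K.topologicalClosureᗮ, V x = W x := by
    intro x hx
    rw [Submodule.orthogonal_closure] at hx
    have h0 : CFC.abs T x = 0 := by
      refine inner_self_eq_zero (𝕜 := ℂ) |>.1 ?_
      have h1 := (Submodule.mem_orthogonal K x).1 hx (CFC.abs T (CFC.abs T x)) ⟨_, rfl⟩
      have h2 : IsSelfAdjoint (CFC.abs T) := (CFC.abs_nonneg T).isSelfAdjoint
      rw [← ContinuousLinearMap.adjoint_inner_right, ← ContinuousLinearMap.star_eq_adjoint,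
        h2.star_eq] at h1
      exact h1
    have hx1 : x ∈ T.ker := hker x h0
    have hx2 : V x = 0 := by rw [← hV.ker_eq] at hx1; exact hx1
    have hx3 : W x = 0 := by rw [← hW.ker_eq] at hx1; exact hx1
    rw [hx2, hx3]
  ext x
  have : K.topologicalClosure.HasOrthogonalProjection := by
    have : CompleteSpace K.topologicalClosure := K.isClosed_topologicalClosure.completeSpace_coe
    infer_instance
  obtain ⟨y, hy, z, hz, rfl⟩ := K.topologicalClosure.exists_add_mem_mem_orthogonal x
  rw [map_add, map_add, hrange y hy, horth z hz]

/-- `F = f(T)` in the sense of the Borel functional calculus of the bounded normal operator `T`: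
for each vector `x`, `⟪x, F x⟫` is the integral of `f` against the spectral measure of `T` at `x`,
i.e. the finite measure `μ` carried by the spectrum with `⟪x, g(T) x⟫ = ∫ g dμ` for every
continuous function `g`. -/
def IsBorelCalculus (T : H →L[ℂ] H) (f : ℂ → ℂ) (F : H →L[ℂ] H) : Prop :=
  ∀ x : H, ∃ μ : MeasureTheory.Measure ℂ, MeasureTheory.IsFiniteMeasure μ ∧
    μ (spectrum ℂ T)ᶜ = 0 ∧
    (∀ g : ℂ → ℂ, Continuous g → ⟪x, cfc g T x⟫_ℂ = ∫ z, g z ∂μ) ∧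
    ⟪x, F x⟫_ℂ = ∫ z, f z ∂μ

/-- The operator `f(T)` is unique. -/
theorem IsBorelCalculus.unique {T F G : H →L[ℂ] H} {f : ℂ → ℂ} (hF : IsBorelCalculus T f F)
    (hG : IsBorelCalculus T f G) : F = G := by
  have key : ∀ x : H, ⟪x, F x⟫_ℂ = ⟪x, G x⟫_ℂ := by
    intro x
    obtain ⟨μ, _, -, h1, h2⟩ := hF x
    obtain ⟨ν, _, -, h3, h4⟩ := hG x
    have : μ = ν := by
      refine MeasureTheory.ext_of_forall_integral_eq_of_IsFiniteMeasure fun φ => ?_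
      have hc : Continuous fun z : ℂ => ((φ z : ℝ) : ℂ) :=
        Complex.continuous_ofReal.comp φ.continuous
      have h5 := (h1 _ hc).symm.trans (h3 _ hc)
      rw [integral_complex_ofReal, integral_complex_ofReal] at h5
      exact_mod_cast h5
    rw [h2, h4, this]
  have h6 : (F : H →ₗ[ℂ] H) = G := by
    rw [← ext_inner_map]
    intro x
    have := congrArg (starRingEnd ℂ) (key x)
    rwa [inner_conj_symm, inner_conj_symm] at this
  exact ContinuousLinearMap.coe_injective h6

end Operators

/-- The function `f` with `f(q^{2n}) = (sgn q)^n` for `n = 0, 1, 2, …` and `f = 1` elsewhere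
(in particular `f(0) = 1`). -/
def signFun (q : ℝ) (z : ℂ) : ℂ :=
  open Classical in
  if h : ∃ n : ℕ, z = (q : ℂ) ^ (2 * n) then ((SignType.sign q : ℝ) : ℂ) ^ h.choose else 1

theorem signFun_pow {q : ℝ} (hq0 : q ≠ 0) (hq1 : |q| < 1) (n : ℕ) :
    signFun q ((q : ℂ) ^ (2 * n)) = ((SignType.sign q : ℝ) : ℂ) ^ n := by
  have h : ∃ m : ℕ, (q : ℂ) ^ (2 * n) = (q : ℂ) ^ (2 * m) := ⟨n, rfl⟩
  have h1 : q ^ (2 * n) = q ^ (2 * h.choose) := by exact_mod_cast h.choose_spec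
  have h2 : |q| ^ (2 * n) = |q| ^ (2 * h.choose) := by rw [← abs_pow, ← abs_pow, h1]
  have h3 : 2 * n = 2 * h.choose := pow_right_injective₀ (abs_pos.2 hq0) hq1.ne h2
  have h4 : h.choose = n := by omega
  rw [signFun, dif_pos h, h4]

theorem signFun_zero {q : ℝ} (hq0 : q ≠ 0) : signFun q 0 = 1 := by
  rw [signFun, dif_neg]
  rintro ⟨n, hn⟩
  exact pow_ne_zero (2 * n) (Complex.ofReal_ne_zero.2 hq0) hn.symm

/-! ### The GNS representation of the Haar state -/

/-- `L^∞(SU_q(2))`: the strong closure of the image of `C(SU_q(2))` in the GNS representation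
of `h`. -/
def Linf {q : ℝ} (h : CSUq q →ₚ[ℂ] ℂ) : Set (h.GNS →L[ℂ] h.GNS) :=
  strongClosure (Set.range h.gnsStarAlgHom)

/-- The center of a set of operators closed under multiplication. -/
def center {H : Type*} [NormedAddCommGroup H] [InnerProductSpace ℂ H]
    (L : Set (H →L[ℂ] H)) : Set (H →L[ℂ] H) :=
  {T ∈ L | ∀ S ∈ L, S * T = T * S}

end SUq

end

/-!
# The center of `L^∞(SU_q(2))`

The proof has two independent halves.

*Operators satisfying the relations.* Let `a`, `g` be operators on a Hilbert space that satisfy the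
relations of `SU_q(2)`, with `g` injective. Since `a a* = 1 - q² g* g` is invertible, `a` has a
polar decomposition inside the algebra: `s = a* (a a*)^(-1/2)` (`SUq.shift`) is an isometry, with
`g s = q s g`. It follows that `g* g s ^ n s* ^ n` has norm at most `q ^ (2 n)`; as `g* g` has dense
range, `s ^ n s* ^ n` tends to zero strongly, so `s` is a pure isometry and the projections
`E n = s ^ n (1 - s s*) s* ^ n` (`SUq.level`) form a resolution of the identity with
`g* g E n = q ^ (2 n) E n`. In other words the space is `ℓ²(ℕ) ⊗ ker a`, with `s` the unilateral
shift of the first factor, and `g = ∑ q ^ n E n ⊗ w` for a unitary `w` of `ker a`. All bounded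
diagonal operators exist (`SUq.IsResolution.exists_mul_eq`). This gives the phase of `g`, the sign
operator `f(g* g)`, and their product `U = 1 ⊗ w`, characterised by `U E n = q ^ (-n) g E n`. The
generated von Neumann algebra is `B(ℓ²) ⊗ W*(w)`, whose center is generated by `U`. Concretely,
an operator on `ker a` commuting with `w` spreads over the levels to an operator in the commutant
(`SUq.Relations.commute_of_spread`), so a central element commutes with every block `E i R E j` of
every `R` in the commutant of `U` and `U*`
(`SUq.Relations.center_centralizer_centralizer`).

*The Haar state.* To apply this to `π_h` one needs that `π_h(γ)` is injective. There is a vector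
state `φ` of `C(SU_q(2))`, in a representation on `ℓ²(ℕ)`, whose vector is annihilated by `α` and
fixed by `γ`. Slicing `Δ(α* ^ n α ^ n)` by `φ` leaves `q ^ (2 n) γ ^ n γ* ^ n`, so invariance gives
`h(α* ^ n α ^ n) = q ^ (2 n) h(γ ^ n γ* ^ n)`, and the powers of `π_h(α)` tend to zero on the cyclic
vector. On the kernel of `π_h(γ)`, which is a reducing subspace, `π_h(α)` is unitary; the kernel is
therefore orthogonal to the cyclic vector, and so it vanishes (`SUq.IsHaarState.ker_gamma`).

That the strong closure is a von Neumann algebra is the double commutant theorem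
(`SUq.strongClosure_eq_centralizer_centralizer`), proved by amplification.
-/

noncomputable section

namespace SUq

/-! ### The double commutant theorem -/

section DoubleCommutant

variable {H : Type*} [NormedAddCommGroup H] [InnerProductSpace ℂ H] [CompleteSpace H]
  {ι : Type*} [Fintype ι]

/-- The diagonal action `T ⊕ ⋯ ⊕ T` of an operator `T` on the Hilbert sum of copies of `H` indexed
by the finite type `ι`. -/
def amplify (ι : Type*) [Fintype ι] (T : H →L[ℂ] H) :
    PiLp 2 (fun _ : ι => H) →L[ℂ] PiLp 2 (fun _ : ι => H) :=
  (PiLp.continuousLinearEquiv 2 ℂ fun _ : ι => H).symm.toContinuousLinearMap ∘L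
    ContinuousLinearMap.pi (fun i => T ∘L PiLp.proj 2 (fun _ : ι => H) i)

omit [CompleteSpace H] in
@[simp]
theorem amplify_apply (T : H →L[ℂ] H) (x : PiLp 2 (fun _ : ι => H)) (i : ι) :
    amplify ι T x i = T (x i) := rfl

theorem inner_amplify_left (T : H →L[ℂ] H) (x y : PiLp 2 (fun _ : ι => H)) :
    ⟪amplify ι T x, y⟫_ℂ = ⟪x, amplify ι (star T) y⟫_ℂ := by
  simp [PiLp.inner_apply, ContinuousLinearMap.star_eq_adjoint,
    ContinuousLinearMap.adjoint_inner_right]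

omit [CompleteSpace H] in
/-- An operator in the double commutant of `S` commutes, after amplification, with every operator
that commutes with the amplification of `S`. -/
theorem commute_amplify_of_mem_centralizer_centralizer [DecidableEq ι] {S : Set (H →L[ℂ] H)}
    {T : H →L[ℂ] H} (hT : T ∈ S.centralizer.centralizer)
    {P : PiLp 2 (fun _ : ι => H) →L[ℂ] PiLp 2 (fun _ : ι => H)}
    (hP : ∀ A ∈ S, ∀ x, P (amplify ι A x) = amplify ι A (P x)) (x : PiLp 2 (fun _ : ι => H)) :
    P (amplify ι T x) = amplify ι T (P x) := by
  let inj : ι → H →L[ℂ] PiLp 2 (fun _ : ι => H) := fun j =>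
    (PiLp.continuousLinearEquiv 2 ℂ fun _ : ι => H).symm.toContinuousLinearMap ∘L
      ContinuousLinearMap.single ℂ (fun _ : ι => H) j
  have hinj : ∀ j v i, inj j v i = (Pi.single j v : ι → H) i := fun _ _ _ => rfl
  have hamp : ∀ (A : H →L[ℂ] H) j v, amplify ι A (inj j v) = inj j (A v) := by
    intro A j v
    ext i
    rw [amplify_apply, hinj, hinj]
    by_cases h : i = j
    · subst h; simp
    · simp [h]
  have hsum : ∀ y : PiLp 2 (fun _ : ι => H), y = ∑ j, inj j (y j) := by
    intro y
    ext i
    have h1 : (∑ j, inj j (y j)) i = ∑ j, (inj j (y j)) i := by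
      simp
    rw [h1]
    simp [hinj, Finset.sum_pi_single]
  -- the matrix entries of `P` lie in the commutant of `S`
  have hentry : ∀ i j v, (P (inj j (T v))) i = T ((P (inj j v)) i) := by
    intro i j v
    let Q : H →L[ℂ] H := PiLp.proj 2 (fun _ : ι => H) i ∘L P ∘L inj j
    have hQ : Q ∈ S.centralizer := by
      intro A hA
      ext w
      change A ((P (inj j w)) i) = (P (inj j (A w))) i
      rw [← hamp, hP A hA, amplify_apply]
    exact congrArg (fun B : H →L[ℂ] H => B v) (hT Q hQ)
  have h2 : amplify ι T x = ∑ j, inj j (T (x j)) := by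
    conv_lhs => rw [hsum x]
    rw [map_sum]
    exact Finset.sum_congr rfl fun j _ => hamp T j _
  rw [h2]
  conv_rhs => rw [hsum x]
  ext i
  rw [map_sum, map_sum, amplify_apply]
  have h3 : ∀ f : ι → PiLp 2 (fun _ : ι => H), (∑ j, f j) i = ∑ j, (f j) i := by
    intro f; simp
  rw [h3, h3, map_sum]
  exact Finset.sum_congr rfl fun j _ => hentry i j _

/-- On finitely many vectors, an operator in the double commutant of a unital *-algebra is
approximated by elements of the algebra. -/
theorem exists_norm_sub_lt_of_mem_centralizer_centralizer [DecidableEq ι]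
    (S : StarSubalgebra ℂ (H →L[ℂ] H)) {T : H →L[ℂ] H}
    (hT : T ∈ (S : Set (H →L[ℂ] H)).centralizer.centralizer) (v : PiLp 2 (fun _ : ι => H))
    {ε : ℝ} (hε : 0 < ε) : ∃ A ∈ S, ∀ i, ‖A (v i) - T (v i)‖ < ε := by
  let N₀ : Submodule ℂ (PiLp 2 (fun _ : ι => H)) :=
    { carrier := {y | ∃ A ∈ S, y = amplify ι A v}
      add_mem' := by
        rintro _ _ ⟨A, hA, rfl⟩ ⟨B, hB, rfl⟩
        exact ⟨A + B, add_mem hA hB, by ext i; simp⟩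
      zero_mem' := ⟨0, zero_mem _, by ext i; simp⟩
      smul_mem' := by
        rintro c _ ⟨A, hA, rfl⟩
        exact ⟨c • A, SMulMemClass.smul_mem c hA, by ext i; simp⟩ }
  let N := N₀.topologicalClosure
  have : CompleteSpace N := N₀.isClosed_topologicalClosure.completeSpace_coe
  have hN : ∀ A ∈ S, ∀ y ∈ N, amplify ι A y ∈ N := by
    intro A hA y hy
    have h1 : Set.MapsTo (amplify ι A) (N₀ : Set (PiLp 2 (fun _ : ι => H))) N₀ := by
      rintro _ ⟨B, hB, rfl⟩
      exact ⟨A * B, mul_mem hA hB, by ext i; simp⟩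
    exact h1.closure (amplify ι A).continuous hy
  have hNo : ∀ A ∈ S, ∀ y ∈ Nᗮ, amplify ι A y ∈ Nᗮ := by
    intro A hA y hy
    rw [Submodule.mem_orthogonal] at hy ⊢
    intro u hu
    have h1 := inner_amplify_left (star A) u y
    rw [star_star] at h1
    rw [← h1]
    exact hy _ (hN _ (star_mem hA) u hu)
  have hcomm := commute_amplify_of_mem_centralizer_centralizer hT (P := N.starProjection) (by
    intro A hA x
    refine Submodule.eq_starProjection_of_mem_orthogonal
      (hN A hA _ (Submodule.starProjection_apply_mem N x)) ?_
    rw [← map_sub]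
    exact hNo A hA _ (Submodule.sub_starProjection_mem_orthogonal x)) v
  have hv : v ∈ N := N₀.le_topologicalClosure ⟨1, one_mem _, by ext i; simp⟩
  have hTv : amplify ι T v ∈ N := by
    rw [Submodule.starProjection_eq_self_iff.2 hv] at hcomm
    rw [← hcomm]
    exact Submodule.starProjection_apply_mem N _
  obtain ⟨_, ⟨A, hA, rfl⟩, hd⟩ := Metric.mem_closure_iff.1 hTv ε hε
  refine ⟨A, hA, fun i => ?_⟩
  have h4 := PiLp.norm_apply_le (p := 2) (amplify ι A v - amplify ι T v) i
  rw [dist_comm, dist_eq_norm] at hd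
  exact lt_of_le_of_lt h4 hd

/-- **von Neumann's double commutant theorem**: the strong closure of a unital *-algebra of
operators is its double commutant. -/
theorem strongClosure_eq_centralizer_centralizer (S : StarSubalgebra ℂ (H →L[ℂ] H)) :
    strongClosure (S : Set (H →L[ℂ] H)) = (S : Set (H →L[ℂ] H)).centralizer.centralizer := by
  classical
  ext T
  constructor
  · intro hT R hR
    have hclosed : IsClosed {X : H →Lₚₜ[ℂ] H | ∀ v, R (X v) = X (R v)} := by
      simp only [Set.ofPred_forall]
      refine isClosed_iInter fun v => isClosed_eq ?_ ?_
      · exact R.continuous.comp (PointwiseConvergenceCLM.evalCLM (RingHom.id ℂ) H v).continuous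
      · exact (PointwiseConvergenceCLM.evalCLM (RingHom.id ℂ) H (R v)).continuous
    ext v
    refine closure_minimal ?_ hclosed hT v
    rintro _ ⟨A, hA, rfl⟩ w
    exact (congrArg (fun B : H →L[ℂ] H => B w) (hR A hA)).symm
  · intro hT
    refine (mem_closure_iff_nhds_basis (PointwiseConvergenceCLM.withSeminorms
      (σ := RingHom.id ℂ) (E := H) (F := H)).hasBasis_ball).2 ?_
    rintro ⟨s, ε⟩ hε
    obtain ⟨A, hA, h⟩ := exists_norm_sub_lt_of_mem_centralizer_centralizer (ι := s) S hT
      (WithLp.toLp 2 fun i => (i : H)) hε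
    refine ⟨_, ⟨A, hA, rfl⟩, ?_⟩
    refine (Seminorm.mem_ball _).2 (Seminorm.finset_sup_apply_lt hε fun w hw => ?_)
    exact h ⟨w, hw⟩

end DoubleCommutant

/-! ### Resolutions of the identity and diagonal operators -/

section Resolution

variable {H : Type*} [NormedAddCommGroup H] [InnerProductSpace ℂ H] [CompleteSpace H]

/-- A sequence of mutually orthogonal projections whose sum is the identity in the strong operator
topology. -/
structure IsResolution (E : ℕ → H →L[ℂ] H) : Prop where
  star_eq : ∀ n, star (E n) = E n
  mul_self : ∀ n, E n * E n = E n
  mul_of_ne : ∀ m n, m ≠ n → E m * E n = 0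
  tendsto : ∀ v, Filter.Tendsto (fun N => ∑ n ∈ Finset.range N, E n v) Filter.atTop (nhds v)

namespace IsResolution

variable {E : ℕ → H →L[ℂ] H} (hE : IsResolution E)

include hE

theorem inner_left (n : ℕ) (x y : H) : ⟪E n x, y⟫_ℂ = ⟪x, E n y⟫_ℂ := by
  conv_lhs => rw [← hE.star_eq n]
  rw [ContinuousLinearMap.star_eq_adjoint, ContinuousLinearMap.adjoint_inner_left]

theorem inner_eq_zero {m n : ℕ} (h : m ≠ n) {x y : H} (hx : E m x = x) (hy : E n y = y) :
    ⟪x, y⟫_ℂ = 0 := by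
  rw [← hx, ← hy, hE.inner_left]
  have h1 : E m (E n y) = 0 := congrArg (fun T : H →L[ℂ] H => T y) (hE.mul_of_ne m n h)
  rw [h1, inner_zero_right]

theorem apply_self (n : ℕ) (v : H) : E n (E n v) = E n v :=
  congrArg (fun T : H →L[ℂ] H => T v) (hE.mul_self n)

theorem orthogonalFamily : OrthogonalFamily ℂ (fun n => (E n).range)
    (fun n => (E n).range.subtypeₗᵢ) := by
  intro m n h
  rintro ⟨_, x, rfl⟩ ⟨_, y, rfl⟩
  exact hE.inner_eq_zero h (hE.apply_self m x) (hE.apply_self n y)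

theorem norm_sum_sq {f : ℕ → H} (hf : ∀ n, E n (f n) = f n) (s : Finset ℕ) :
    ‖∑ n ∈ s, f n‖ ^ 2 = ∑ n ∈ s, ‖f n‖ ^ 2 :=
  hE.orthogonalFamily.norm_sum (fun n => ⟨f n, f n, hf n⟩) s

theorem summable_iff {f : ℕ → H} (hf : ∀ n, E n (f n) = f n) :
    Summable f ↔ Summable fun n => ‖f n‖ ^ 2 :=
  hE.orthogonalFamily.summable_iff_norm_sq_summable (fun n => ⟨f n, f n, hf n⟩)

/-- Bessel's inequality. -/
theorem sum_norm_sq_le (s : Finset ℕ) (v : H) : ∑ n ∈ s, ‖E n v‖ ^ 2 ≤ ‖v‖ ^ 2 := by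
  have h1 : ∑ n ∈ s, ‖E n v‖ ^ 2 = RCLike.re ⟪∑ n ∈ s, E n v, v⟫_ℂ := by
    rw [sum_inner, map_sum]
    refine Finset.sum_congr rfl fun n _ => ?_
    rw [← inner_self_eq_norm_sq (𝕜 := ℂ), ← hE.inner_left, hE.apply_self]
  have h2 := hE.norm_sum_sq (fun n => hE.apply_self n v) s
  have h3 : RCLike.re ⟪∑ n ∈ s, E n v, v⟫_ℂ ≤ ‖∑ n ∈ s, E n v‖ * ‖v‖ := re_inner_le_norm _ _
  nlinarith [sq_nonneg (‖∑ n ∈ s, E n v‖ - ‖v‖)]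

theorem hasSum (v : H) : HasSum (fun n => E n v) v := by
  have h1 : Summable fun n => E n v := (hE.summable_iff fun n => hE.apply_self n v).2
    (summable_of_sum_le (fun _ => sq_nonneg _) fun s => hE.sum_norm_sq_le s v)
  have h2 := tendsto_nhds_unique h1.hasSum.tendsto_sum_nat (hE.tendsto v)
  have h3 := h1.hasSum
  rwa [h2] at h3

theorem hasSum_norm_sq (v : H) : HasSum (fun n => ‖E n v‖ ^ 2) (‖v‖ ^ 2) := by
  have h1 : Summable fun n => ‖E n v‖ ^ 2 :=
    summable_of_sum_le (fun _ => sq_nonneg _) fun s => hE.sum_norm_sq_le s v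
  have h2 : Filter.Tendsto (fun N => ‖∑ n ∈ Finset.range N, E n v‖ ^ 2) Filter.atTop
      (nhds (‖v‖ ^ 2)) := ((hE.tendsto v).norm).pow 2
  simp only [hE.norm_sum_sq fun n => hE.apply_self n v] at h2
  exact tendsto_nhds_unique h1.hasSum.tendsto_sum_nat h2 ▸ h1.hasSum

/-- Operators that agree on every piece of the resolution are equal. -/
theorem ext_of_mul_eq {A B : H →L[ℂ] H} (h : ∀ n, A * E n = B * E n) : A = B := by
  ext v
  have h1 := (hE.hasSum v).mapL A
  have h2 := (hE.hasSum v).mapL B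
  have h3 : (fun n => A (E n v)) = fun n => B (E n v) :=
    funext fun n => congrArg (fun T : H →L[ℂ] H => T v) (h n)
  rw [h3] at h1
  exact h1.unique h2

/-- A bounded sequence of operators `T n` living on the pieces of the resolution adds up to a
bounded operator. -/
theorem exists_mul_eq {T : ℕ → H →L[ℂ] H} (hl : ∀ n, E n * T n = T n) (hr : ∀ n, T n * E n = T n)
    {C : ℝ} (hC : 0 ≤ C) (hT : ∀ n, ‖T n‖ ≤ C) : ∃ D : H →L[ℂ] H, ∀ n, D * E n = T n := by
  have hl' : ∀ v n, E n (T n v) = T n v := fun v n =>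
    congrArg (fun A : H →L[ℂ] H => A v) (hl n)
  have hr' : ∀ v n, T n (E n v) = T n v := fun v n =>
    congrArg (fun A : H →L[ℂ] H => A v) (hr n)
  have hle : ∀ v n, ‖T n v‖ ^ 2 ≤ C ^ 2 * ‖E n v‖ ^ 2 := by
    intro v n
    rw [← mul_pow, ← hr']
    gcongr
    exact (T n).le_of_opNorm_le (hT n) _
  have hsum : ∀ v (s : Finset ℕ), ∑ n ∈ s, ‖T n v‖ ^ 2 ≤ C ^ 2 * ‖v‖ ^ 2 := by
    intro v s
    refine (Finset.sum_le_sum fun n _ => hle v n).trans ?_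
    rw [← Finset.mul_sum]
    gcongr
    exact hE.sum_norm_sq_le s v
  have hS : ∀ v, Summable fun n => T n v := fun v =>
    (hE.summable_iff (hl' v)).2 (summable_of_sum_le (fun _ => sq_nonneg _) (hsum v))
  let D : H →ₗ[ℂ] H :=
    { toFun := fun v => ∑' n, T n v
      map_add' := fun v w => by simp only [map_add]; exact (hS v).tsum_add (hS w)
      map_smul' := fun c v => by
        simp only [map_smul, RingHom.id_apply]; exact (hS v).tsum_const_smul c }
  have hD : ∀ v, ‖D v‖ ≤ C * ‖v‖ := by
    intro v
    refine le_of_tendsto (hS v).hasSum.norm (Filter.Eventually.of_forall fun s => ?_)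
    refine abs_le_of_sq_le_sq' ?_ (by positivity) |>.2
    rw [hE.norm_sum_sq (hl' v), mul_pow]
    exact hsum v s
  refine ⟨D.mkContinuous C hD, fun n => ?_⟩
  ext v
  change ∑' m, T m (E n v) = T n v
  rw [tsum_eq_single n, hr']
  intro m hm
  rw [← hr']
  have h1 : E m (E n v) = 0 := congrArg (fun T : H →L[ℂ] H => T v) (hE.mul_of_ne m n hm)
  rw [h1, map_zero]

/-- A diagonal operator commutes with the resolution. -/
theorem mul_eq_of_mul_eq {T : ℕ → H →L[ℂ] H} (hl : ∀ n, E n * T n = T n) {D : H →L[ℂ] H}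
    (hD : ∀ n, D * E n = T n) (n : ℕ) : E n * D = T n := by
  refine hE.ext_of_mul_eq fun m => ?_
  rw [mul_assoc, hD, ← hl m, ← mul_assoc, ← hD n, mul_assoc D]
  by_cases h : n = m
  · subst h
    rw [hE.mul_self, hl, hD]
  · rw [hE.mul_of_ne n m h, zero_mul, mul_zero]

/-- The adjoint of a diagonal operator is diagonal. -/
theorem star_mul_eq {T : ℕ → H →L[ℂ] H} (hl : ∀ n, E n * T n = T n) {D : H →L[ℂ] H}
    (hD : ∀ n, D * E n = T n) (n : ℕ) : star D * E n = star (T n) := by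
  rw [← hE.mul_eq_of_mul_eq hl hD, star_mul, hE.star_eq]

end IsResolution

end Resolution

/-! ### Operators satisfying the relations of `SU_q(2)` -/

section Structure

variable {H : Type*} [NormedAddCommGroup H] [InnerProductSpace ℂ H] [CompleteSpace H]
  {q : ℝ} {a g : H →L[ℂ] H}

/-- The adjoint of the partial isometry in the polar decomposition of `a`, defined for invertible
`a a*` as `a* (a a*)^(-1/2)`. -/
def shift (a : H →L[ℂ] H) : H →L[ℂ] H := star a * (a * star a) ^ (-(1 / 2) : ℝ)

/-- The projection onto the image under `(shift a) ^ n` of the kernel of `a`. -/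
def level (a : H →L[ℂ] H) (n : ℕ) : H →L[ℂ] H :=
  shift a ^ n * (1 - shift a * star (shift a)) * star (shift a) ^ n

namespace Relations

variable (hr : Relations q a g)

include hr

theorem isStarNormal_g : IsStarNormal g := ⟨hr.normal_g⟩

theorem norm_star_g_pow_le (n : ℕ) : ‖star g ^ n‖ ≤ 1 := by
  rw [← star_pow, norm_star]
  induction n with
  | zero => rw [pow_zero]; exact ContinuousLinearMap.norm_id_le
  | succ n ih =>
    rw [pow_succ]
    exact (norm_mul_le _ _).trans (mul_le_one₀ ih (norm_nonneg _) hr.norm_a_le.2)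

theorem a_mul_star_g : a * star g = (q : ℂ) • (star g * a) := by
  have h : SemiconjBy a g ((q : ℂ) • g) := by
    rw [SemiconjBy, hr.a_mul_g, smul_mul_assoc]
  have h1 : IsStarNormal ((q : ℂ) • g) :=
    ⟨by simp [Commute, SemiconjBy, hr.normal_g]⟩
  have h2 := (h.star_right hr.isStarNormal_g h1).eq
  simpa using h2

theorem g_mul_star_a : g * star a = (q : ℂ) • (star a * g) := by
  simpa using congrArg star hr.a_mul_star_g

theorem star_g_mul_star_a : star g * star a = (q : ℂ) • (star a * star g) := by
  simpa using congrArg star hr.a_mul_g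

theorem isUnit_a_mul_star_a (hq1 : |q| < 1) : IsUnit (a * star a) := by
  rw [← eq_sub_iff_add_eq.2 hr.a_mul_star_a |>.symm]
  refine isUnit_one_sub_of_norm_lt_one ?_
  rw [norm_smul, CStarRing.norm_star_mul_self]
  have h1 := hr.norm_a_le.2
  have h2 : ‖(q : ℂ) ^ 2‖ < 1 := by
    rw [norm_pow, Complex.norm_real, Real.norm_eq_abs]
    nlinarith [abs_nonneg q]
  have h3 : ‖g‖ * ‖g‖ ≤ 1 := by nlinarith [norm_nonneg g]
  nlinarith [norm_nonneg ((q : ℂ) ^ 2)]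

theorem isStrictlyPositive (hq1 : |q| < 1) : IsStrictlyPositive (a * star a) :=
  (hr.isUnit_a_mul_star_a hq1).isStrictlyPositive (mul_star_self_nonneg a)

theorem commute_rpow {B : H →L[ℂ] H} (hB : Commute (star g * g) B) (t : ℝ) :
    Commute ((a * star a) ^ t) B := by
  rw [CFC.rpow_def]
  refine Commute.cfc_nnreal ?_ _
  rw [eq_sub_iff_add_eq.2 hr.a_mul_star_a]
  exact (Commute.one_left B).sub_left (hB.smul_left _)

theorem g_commute_star_g_mul_g : Commute (star g * g) g := by
  rw [commute_iff_eq, hr.normal_g, mul_assoc, hr.normal_g]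

theorem star_g_commute_star_g_mul_g : Commute (star g * g) (star g) := by
  rw [commute_iff_eq, mul_assoc, hr.normal_g]

omit hr in
theorem star_rpow (t : ℝ) : star ((a * star a) ^ t) = (a * star a) ^ t :=
  CFC.rpow_nonneg.isSelfAdjoint.star_eq

theorem rpow_mul_rpow_mul (hq1 : |q| < 1) :
    (a * star a) ^ (-(1 / 2) : ℝ) * (a * star a) * (a * star a) ^ (-(1 / 2) : ℝ) = 1 := by
  have h0 := hr.isStrictlyPositive hq1
  conv_lhs => enter [1, 2]; rw [← CFC.rpow_one (a * star a) h0.nonneg]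
  rw [← CFC.rpow_add h0.isUnit, ← CFC.rpow_add h0.isUnit]
  norm_num
  exact CFC.rpow_zero _ h0.nonneg

omit hr in
theorem star_shift : star (shift a) = (a * star a) ^ (-(1 / 2) : ℝ) * a := by
  rw [shift, star_mul, star_star, star_rpow]

theorem star_shift_mul_shift (hq1 : |q| < 1) : star (shift a) * shift a = 1 := by
  rw [star_shift, shift, ← hr.rpow_mul_rpow_mul hq1]
  simp only [mul_assoc]

theorem star_a_eq (hq1 : |q| < 1) : star a = shift a * (a * star a) ^ (1 / 2 : ℝ) := by
  rw [shift, mul_assoc, CFC.rpow_neg_mul_rpow _ (hr.isStrictlyPositive hq1), mul_one]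

/-- The polar decomposition of `a`. -/
theorem a_eq (hq1 : |q| < 1) : a = (a * star a) ^ (1 / 2 : ℝ) * star (shift a) := by
  rw [star_shift, ← mul_assoc, CFC.rpow_mul_rpow_neg _ (hr.isStrictlyPositive hq1), one_mul]

theorem norm_shift_le (hq1 : |q| < 1) : ‖shift a‖ ≤ 1 := by
  have h1 := CStarRing.norm_star_mul_self (x := shift a)
  rw [hr.star_shift_mul_shift hq1] at h1
  have h2 : ‖(1 : H →L[ℂ] H)‖ ≤ 1 := ContinuousLinearMap.norm_id_le
  nlinarith [norm_nonneg (shift a)]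

theorem norm_shift_pow_le (hq1 : |q| < 1) (n : ℕ) : ‖shift a ^ n‖ ≤ 1 := by
  induction n with
  | zero => rw [pow_zero]; exact ContinuousLinearMap.norm_id_le
  | succ n ih =>
    rw [pow_succ]
    exact (norm_mul_le _ _).trans (mul_le_one₀ ih (norm_nonneg _) (hr.norm_shift_le hq1))

theorem norm_star_shift_pow_le (hq1 : |q| < 1) (n : ℕ) : ‖star (shift a) ^ n‖ ≤ 1 := by
  rw [← star_pow, norm_star]
  exact hr.norm_shift_pow_le hq1 n

/-! ### Commutation of the generators with the isometry -/

theorem g_mul_shift : g * shift a = (q : ℂ) • (shift a * g) := by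
  rw [shift, ← mul_assoc, hr.g_mul_star_a, smul_mul_assoc, mul_assoc,
    ← (hr.commute_rpow hr.g_commute_star_g_mul_g _).eq, mul_assoc]

theorem star_g_mul_shift : star g * shift a = (q : ℂ) • (shift a * star g) := by
  rw [shift, ← mul_assoc, hr.star_g_mul_star_a, smul_mul_assoc, mul_assoc,
    ← (hr.commute_rpow hr.star_g_commute_star_g_mul_g _).eq, mul_assoc]

theorem star_shift_mul_g : star (shift a) * g = (q : ℂ) • (g * star (shift a)) := by
  simpa using congrArg star hr.star_g_mul_shift

theorem g_mul_shift_pow (n : ℕ) : g * shift a ^ n = (q : ℂ) ^ n • (shift a ^ n * g) := by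
  induction n with
  | zero => simp
  | succ n ih =>
    rw [pow_succ, ← mul_assoc, ih, smul_mul_assoc, mul_assoc, hr.g_mul_shift, mul_smul_comm,
      smul_smul, pow_succ, mul_assoc]

theorem star_g_mul_shift_pow (n : ℕ) :
    star g * shift a ^ n = (q : ℂ) ^ n • (shift a ^ n * star g) := by
  induction n with
  | zero => simp
  | succ n ih =>
    rw [pow_succ, ← mul_assoc, ih, smul_mul_assoc, mul_assoc, hr.star_g_mul_shift, mul_smul_comm,
      smul_smul, pow_succ, mul_assoc]

theorem star_shift_pow_mul_g (n : ℕ) :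
    star (shift a) ^ n * g = (q : ℂ) ^ n • (g * star (shift a) ^ n) := by
  simpa using congrArg star (hr.star_g_mul_shift_pow n)

theorem g_commute_shift_pow_mul_star_pow (n : ℕ) :
    Commute g (shift a ^ n * star (shift a) ^ n) := by
  rw [commute_iff_eq, ← mul_assoc, hr.g_mul_shift_pow, mul_assoc, hr.star_shift_pow_mul_g,
    mul_smul_comm, smul_mul_assoc, mul_assoc]

theorem g_mul_level (n : ℕ) : g * level a n =
    (q : ℂ) ^ n • (shift a ^ n * (g * (1 - shift a * star (shift a))) * star (shift a) ^ n) := by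
  rw [level, mul_assoc, ← mul_assoc g, hr.g_mul_shift_pow, smul_mul_assoc]
  simp only [mul_assoc]

omit hr in
theorem level_eq_sub (n : ℕ) : level a n =
    shift a ^ n * star (shift a) ^ n - shift a ^ (n + 1) * star (shift a) ^ (n + 1) := by
  rw [level, pow_succ (shift a), pow_succ' (star (shift a))]
  noncomm_ring

theorem g_commute_level (n : ℕ) : Commute g (level a n) := by
  rw [level_eq_sub]
  exact (hr.g_commute_shift_pow_mul_star_pow n).sub_right
    (hr.g_commute_shift_pow_mul_star_pow (n + 1))

omit hr in
theorem star_level (n : ℕ) : star (level a n) = level a n := by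
  simp [level, mul_assoc]

theorem star_g_commute_level (n : ℕ) : Commute (star g) (level a n) := by
  have h := (hr.g_commute_level n).star_star
  rwa [star_level] at h

/-! ### The levels form a resolution of the identity -/

theorem star_shift_pow_mul_shift_pow (hq1 : |q| < 1) (n : ℕ) :
    star (shift a) ^ n * shift a ^ n = 1 := by
  induction n with
  | zero => simp
  | succ n ih =>
    rw [pow_succ, pow_succ', mul_assoc, ← mul_assoc (star (shift a)),
      hr.star_shift_mul_shift hq1, one_mul, ih]

theorem level_zero_mul_shift (hq1 : |q| < 1) :
    (1 - shift a * star (shift a)) * shift a = 0 := by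
  rw [sub_mul, one_mul, mul_assoc, hr.star_shift_mul_shift hq1, mul_one, sub_self]

theorem star_shift_mul_level_zero (hq1 : |q| < 1) :
    star (shift a) * (1 - shift a * star (shift a)) = 0 := by
  rw [mul_sub, mul_one, ← mul_assoc, hr.star_shift_mul_shift hq1, one_mul, sub_self]

theorem level_mul_level_of_lt (hq1 : |q| < 1) {m n : ℕ} (h : m < n) :
    level a m * level a n = 0 := by
  obtain ⟨k, rfl⟩ := Nat.exists_eq_add_of_lt h
  have h1 : star (shift a) ^ m * shift a ^ (m + k + 1) = shift a * shift a ^ k := by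
    rw [add_assoc, pow_add, ← mul_assoc, hr.star_shift_pow_mul_shift_pow hq1, one_mul, pow_succ']
  calc level a m * level a (m + k + 1)
      = shift a ^ m * (1 - shift a * star (shift a)) *
          (star (shift a) ^ m * shift a ^ (m + k + 1)) *
          (1 - shift a * star (shift a)) * star (shift a) ^ (m + k + 1) := by
        simp only [level, mul_assoc]
    _ = shift a ^ m * ((1 - shift a * star (shift a)) * shift a) * shift a ^ k *
          (1 - shift a * star (shift a)) * star (shift a) ^ (m + k + 1) := by
        rw [h1]; simp only [mul_assoc]
    _ = 0 := by rw [hr.level_zero_mul_shift hq1]; simp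

theorem level_zero_mul_self (hq1 : |q| < 1) :
    (1 - shift a * star (shift a)) * (1 - shift a * star (shift a)) =
      1 - shift a * star (shift a) := by
  rw [mul_sub, mul_one, ← mul_assoc, hr.level_zero_mul_shift hq1, zero_mul, sub_zero]

theorem level_mul_self (hq1 : |q| < 1) (n : ℕ) : level a n * level a n = level a n := by
  calc level a n * level a n
      = shift a ^ n * (1 - shift a * star (shift a)) * (star (shift a) ^ n * shift a ^ n) *
          (1 - shift a * star (shift a)) * star (shift a) ^ n := by
        simp only [level, mul_assoc]
    _ = shift a ^ n * ((1 - shift a * star (shift a)) * (1 - shift a * star (shift a))) *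
          star (shift a) ^ n := by
        rw [hr.star_shift_pow_mul_shift_pow hq1, mul_one]; simp only [mul_assoc]
    _ = level a n := by rw [hr.level_zero_mul_self hq1, level]

theorem shift_mul_level (hq1 : |q| < 1) (n : ℕ) :
    shift a * level a n = level a (n + 1) * shift a := by
  simp only [level, mul_assoc, pow_succ' (shift a), pow_succ (star (shift a)),
    hr.star_shift_mul_shift hq1, mul_one]

theorem star_g_mul_g_mul_level (hq1 : |q| < 1) (n : ℕ) :
    star g * g * level a n = (q : ℂ) ^ (2 * n) • level a n := by
  have h0 : a * (1 - shift a * star (shift a)) = 0 := by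
    conv_lhs => enter [1]; rw [hr.a_eq hq1]
    rw [mul_assoc, hr.star_shift_mul_level_zero hq1, mul_zero]
  have h1 : star g * (g * (1 - shift a * star (shift a))) = 1 - shift a * star (shift a) := by
    have h2 := congrArg (· * (1 - shift a * star (shift a))) hr.star_a_mul_a
    simp only [add_mul, one_mul, mul_assoc, h0, mul_zero, zero_add] at h2
    simpa only [mul_assoc] using h2
  rw [mul_assoc, hr.g_mul_level, mul_smul_comm, mul_assoc, ← mul_assoc (star g),
    hr.star_g_mul_shift_pow, smul_mul_assoc, smul_smul, mul_assoc, ← mul_assoc (star g), h1, level,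
    two_mul, pow_add, mul_assoc]

/-- If `g` is injective then `(shift a) ^ n (shift a)* ^ n` tends to zero strongly, as its product
with `g* g`, an operator with dense range, has norm at most `q ^ (2 n)`. -/
theorem tendsto_shift_pow (hq1 : |q| < 1) (hg : g.ker = ⊥) (v : H) :
    Filter.Tendsto (fun n => (shift a ^ n * star (shift a) ^ n) v) Filter.atTop (nhds 0) := by
  have hnorm : ∀ n, ‖shift a ^ n * star (shift a) ^ n‖ ≤ 1 := fun n => (norm_mul_le _ _).trans
    (mul_le_one₀ (hr.norm_shift_pow_le hq1 n) (norm_nonneg _) (hr.norm_star_shift_pow_le hq1 n))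
  have hgn : ∀ n, ‖shift a ^ n * star (shift a) ^ n * g‖ ≤ |q| ^ n := by
    intro n
    rw [mul_assoc, hr.star_shift_pow_mul_g, mul_smul_comm, norm_smul, norm_pow, Complex.norm_real,
      Real.norm_eq_abs]
    refine mul_le_of_le_one_right (by positivity) ((norm_mul_le _ _).trans
      (mul_le_one₀ (hr.norm_shift_pow_le hq1 n) (norm_nonneg _) ((norm_mul_le _ _).trans
      (mul_le_one₀ hr.norm_a_le.2 (norm_nonneg _) (hr.norm_star_shift_pow_le hq1 n)))))
  have hdense : Dense (g.range : Set H) := by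
    rw [Submodule.dense_iff_topologicalClosure_eq_top, Submodule.topologicalClosure_eq_top_iff,
      ContinuousLinearMap.orthogonal_range, Submodule.eq_bot_iff]
    intro w hw
    have h1 : (star g * g) w = 0 := by
      rw [hr.normal_g]
      exact (congrArg g hw).trans (map_zero g)
    have h2 : g w = 0 := by
      rw [← inner_self_eq_zero (𝕜 := ℂ), ← ContinuousLinearMap.adjoint_inner_left]
      rw [ContinuousLinearMap.star_eq_adjoint] at h1
      exact (congrArg (fun z => ⟪z, w⟫_ℂ) h1).trans (inner_zero_left _)
    have h3 : w ∈ g.ker := h2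
    rwa [hg] at h3
  rw [Metric.tendsto_atTop]
  intro ε hε
  obtain ⟨_, ⟨w, rfl⟩, hw⟩ := Metric.mem_closure_iff.1 (hdense v) (ε / 2) (half_pos hε)
  have hlim : Filter.Tendsto (fun n => |q| ^ n * ‖w‖) Filter.atTop (nhds 0) := by
    simpa using (tendsto_pow_atTop_nhds_zero_of_lt_one (abs_nonneg q) hq1).mul_const ‖w‖
  obtain ⟨N, hN⟩ := Filter.eventually_atTop.1 (hlim.eventually_lt_const (half_pos hε))
  refine ⟨N, fun n hn => ?_⟩
  rw [dist_zero_right]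
  have h1 : (shift a ^ n * star (shift a) ^ n) v = (shift a ^ n * star (shift a) ^ n) (v - g w) +
      (shift a ^ n * star (shift a) ^ n * g) w := by
    rw [map_sub, mul_apply_eq_comp]
    exact (sub_add_cancel _ _).symm
  have h2 := ContinuousLinearMap.le_of_opNorm_le _ (hnorm n) (v - g w)
  have h3 := ContinuousLinearMap.le_of_opNorm_le _ (hgn n) w
  rw [dist_eq_norm] at hw
  calc _ ≤ _ := h1 ▸ norm_add_le _ _
    _ < ε / 2 + ε / 2 := by
      refine add_lt_add_of_le_of_lt (h2.trans ?_) (h3.trans_lt (hN n hn))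
      rw [one_mul]
      exact hw.le
    _ = ε := add_halves ε

theorem isResolution_level (hq1 : |q| < 1) (hg : g.ker = ⊥) : IsResolution (level a) where
  star_eq := star_level
  mul_self := hr.level_mul_self hq1
  mul_of_ne m n h := by
    rcases lt_or_gt_of_ne h with h | h
    · exact hr.level_mul_level_of_lt hq1 h
    · simpa [star_level] using congrArg star (hr.level_mul_level_of_lt hq1 h)
  tendsto v := by
    have h1 : ∀ N, ∑ n ∈ Finset.range N, level a n v =
        v - (shift a ^ N * star (shift a) ^ N) v := by
      intro N
      have h2 := Finset.sum_range_sub' (fun n => (shift a ^ n * star (shift a) ^ n) v) N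
      simp only [level_eq_sub, sub_apply]
      rw [h2]
      simp
    simp only [h1]
    simpa using (hr.tendsto_shift_pow hq1 hg v).const_sub v

end Relations

end Structure

/-! ### Functional calculus of diagonal operators -/

section Calculus

variable {H : Type*} [NormedAddCommGroup H] [InnerProductSpace ℂ H] [CompleteSpace H]

omit [CompleteSpace H] in
theorem mem_spectrum_of_apply_eq {T : H →L[ℂ] H} {z : ℂ} {v : H} (hv : v ≠ 0)
    (h : T v = z • v) : z ∈ spectrum ℂ T := by
  rw [spectrum.mem_iff]
  rintro ⟨u, hu⟩
  have h1 : (algebraMap ℂ (H →L[ℂ] H) z - T) v = 0 := by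
    simp [Algebra.algebraMap_eq_smul_one, h]
  have h2 : ((u⁻¹ : (H →L[ℂ] H)ˣ) : H →L[ℂ] H) ((u : H →L[ℂ] H) v) = v :=
    congrArg (fun A : H →L[ℂ] H => A v) u.inv_mul
  rw [hu, h1, map_zero] at h2
  exact hv h2.symm

/-- The continuous functional calculus acts on a joint eigenvector of `T` and `T*` through the
value of the function at the eigenvalue. -/
theorem cfc_apply_eq_of_apply_eq {T : H →L[ℂ] H} [hT : IsStarNormal T] {z : ℂ} {v : H}
    (h1 : T v = z • v) (h2 : star T v = star z • v) {f : ℂ → ℂ} (hf : Continuous f) :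
    cfc f T v = f z • v := by
  by_cases hv : v = 0
  · simp [hv]
  have hz := mem_spectrum_of_apply_eq hv h1
  have key : ∀ φ : C(spectrum ℂ T, ℂ), cfcHom hT φ v = φ ⟨z, hz⟩ • v := by
    intro φ
    induction φ using ContinuousMap.induction_on_of_compact with
    | const r =>
      have h3 : ContinuousMap.const (spectrum ℂ T) r = algebraMap ℂ C(spectrum ℂ T, ℂ) r := rfl
      rw [h3, AlgHomClass.commutes]
      simp [Algebra.algebraMap_eq_smul_one]
    | id => rw [cfcHom_id hT]; exact h1
    | star_id => rw [map_star, cfcHom_id hT]; exact h2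
    | add φ ψ h3 h4 => rw [map_add, add_apply, h3, h4, ← add_smul]; rfl
    | mul φ ψ h3 h4 =>
      rw [map_mul, mul_apply_eq_comp, h4, map_smul, h3, smul_smul, mul_comm]; rfl
    | frequently φ h3 =>
      have h4 : IsClosed {ψ : C(spectrum ℂ T, ℂ) | cfcHom hT ψ v = ψ ⟨z, hz⟩ • v} := by
        refine isClosed_eq ?_ ?_
        · exact (ContinuousLinearMap.apply ℂ H v).continuous.comp (cfcHom_continuous hT)
        · exact (continuous_eval_const (⟨z, hz⟩ : spectrum ℂ T)).smul continuous_const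
      exact h4.closure_subset (mem_closure_iff_frequently.2 h3)
  rw [cfc_apply f T hT hf.continuousOn, key]
  rfl

open MeasureTheory in
/-- If `T` acts on the pieces of a resolution of the identity by distinct scalars `z n`, then
`f(T)` is the operator acting on them by the scalars `f (z n)`. -/
theorem IsResolution.isBorelCalculus {E : ℕ → H →L[ℂ] H} (hE : IsResolution E) {T : H →L[ℂ] H}
    [IsStarNormal T] {z : ℕ → ℂ} (hz : Function.Injective z) {r : ℝ} (hzr : ∀ n, ‖z n‖ ≤ r)
    (h1 : ∀ n, T * E n = z n • E n) (h2 : ∀ n, star T * E n = star (z n) • E n)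
    {f : ℂ → ℂ} {C : ℝ} (hC : ∀ n, ‖f (z n)‖ ≤ C) {F : H →L[ℂ] H}
    (hF : ∀ n, F * E n = f (z n) • E n) : IsBorelCalculus T f F := by
  intro v
  have happ : ∀ {A : H →L[ℂ] H} {n : ℕ} {c : ℂ}, A * E n = c • E n →
      A (E n v) = c • E n v := fun h => congrArg (fun B : H →L[ℂ] H => B v) h
  let ν : Measure ℕ := Measure.sum fun n => ENNReal.ofReal (‖E n v‖ ^ 2) • Measure.dirac n
  have hν : ∀ n, ν {n} = ENNReal.ofReal (‖E n v‖ ^ 2) := fun n => Measure.sum_smul_dirac_singleton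
  have hνfin : IsFiniteMeasure ν := by
    constructor
    rw [Measure.sum_apply _ MeasurableSet.univ]
    simp only [Measure.smul_apply, measure_univ, smul_eq_mul, mul_one]
    rw [← ENNReal.ofReal_tsum_of_nonneg (fun _ => sq_nonneg _) (hE.hasSum_norm_sq v).summable]
    exact ENNReal.ofReal_lt_top
  have hemb : MeasurableEmbedding z :=
    ⟨hz, measurable_of_countable _, fun s _ => ((Set.to_countable s).image z).measurableSet⟩
  have hint : ∀ (φ : ℂ → ℂ) (D : H →L[ℂ] H) (K : ℝ), (∀ n, ‖φ (z n)‖ ≤ K) →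
      (∀ n, D (E n v) = φ (z n) • E n v) → ⟪v, D v⟫_ℂ = ∫ w, φ w ∂(ν.map z) := by
    intro φ D K hK hD
    rw [hemb.integral_map, integral_countable (Integrable.of_bound
      (measurable_of_countable _).aestronglyMeasurable K (Filter.Eventually.of_forall hK))]
    have h3 := ((hE.hasSum v).mapL D).mapL (innerSL ℂ v)
    refine (h3.tsum_eq.symm.trans (tsum_congr fun n => ?_))
    rw [innerSL_apply_apply, hD, inner_smul_right, measureReal_def, hν,
      ENNReal.toReal_ofReal (sq_nonneg _), ← hE.apply_self, ← hE.inner_left,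
      inner_self_eq_norm_sq_to_K, hE.apply_self, Complex.real_smul, mul_comm]
    push_cast
    rfl
  refine ⟨ν.map z, Measure.isFiniteMeasure_map ν z, ?_, fun φ hφ => ?_, ?_⟩
  · rw [hemb.map_apply, Measure.sum_apply _ (Set.to_countable _).measurableSet,
      ENNReal.tsum_eq_zero]
    intro n
    rw [Measure.smul_apply, Measure.dirac_apply, smul_eq_mul, mul_eq_zero]
    by_cases h3 : E n v = 0
    · left; simp [h3]
    · right
      exact Set.indicator_of_notMem
        (fun hn : n ∈ z ⁻¹' (spectrum ℂ T)ᶜ => hn (mem_spectrum_of_apply_eq h3 (happ (h1 n)))) _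
  · obtain ⟨K, hK⟩ := (isCompact_closedBall (0 : ℂ) r).exists_bound_of_continuousOn
      hφ.continuousOn
    exact hint φ _ K (fun n => hK _ (mem_closedBall_zero_iff.2 (hzr n))) fun n =>
      cfc_apply_eq_of_apply_eq (happ (h1 n)) (happ (h2 n)) hφ
  · exact hint f F C hC fun n => happ (hF n)

omit [CompleteSpace H] in
/-- A positive operator whose square acts on the range of `P` by the scalar `c ^ 2`, for some
`c > 0`, acts on it by the scalar `c`. -/
theorem mul_eq_smul_of_mul_self_mul_eq {A P : H →L[ℂ] H} (hA : 0 ≤ A) {c : ℝ} (hc : 0 < c)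
    (h : A * A * P = ((c : ℂ) ^ 2) • P) : A * P = (c : ℂ) • P := by
  ext v
  have h1 : A (A (P v)) = ((c : ℂ) ^ 2) • P v := congrArg (fun B : H →L[ℂ] H => B v) h
  let w : H := A (P v) - (c : ℂ) • P v
  have hw : A w + (c : ℂ) • w = 0 := by
    simp only [w, map_sub, map_smul, h1, smul_sub, smul_smul]
    rw [sq]; abel
  have h2 : RCLike.re ⟪A w, w⟫_ℂ + c * ‖w‖ ^ 2 = 0 := by
    have h3 := congrArg (fun y => RCLike.re ⟪y, w⟫_ℂ) hw
    simp only [inner_add_left, inner_smul_left, inner_zero_left, map_add, map_zero,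
      inner_self_eq_norm_sq_to_K, Complex.conj_ofReal] at h3
    rw [← h3]
    congr 1
    change c * ‖w‖ ^ 2 = ((c : ℂ) * ((‖w‖ : ℝ) : ℂ) ^ 2).re
    rw [← Complex.ofReal_pow, ← Complex.ofReal_mul, Complex.ofReal_re]
  have h4 : 0 ≤ RCLike.re ⟪A w, w⟫_ℂ :=
    ((ContinuousLinearMap.nonneg_iff_isPositive A).1 hA).re_inner_nonneg_left w
  have h5 : ‖w‖ ^ 2 = 0 := by
    have := sq_nonneg ‖w‖
    nlinarith
  exact sub_eq_zero.1 (norm_eq_zero.1 (pow_eq_zero_iff (two_ne_zero) |>.1 h5))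

end Calculus

/-! ### The phase, the sign and the central unitary -/

section Central

variable {H : Type*} [NormedAddCommGroup H] [InnerProductSpace ℂ H] [CompleteSpace H]
  {q : ℝ} {a g : H →L[ℂ] H}

namespace Relations

variable (hr : Relations q a g)

include hr

theorem level_mul_g_mul_level (hq1 : |q| < 1) (n : ℕ) :
    level a n * (g * level a n) = g * level a n := by
  rw [(hr.g_commute_level n).eq, ← mul_assoc, hr.level_mul_self hq1]

theorem norm_g_mul_level_le (hq1 : |q| < 1) (n : ℕ) : ‖g * level a n‖ ≤ |q| ^ n := by
  have h0 : ‖1 - shift a * star (shift a)‖ ≤ 1 := by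
    have h1 := CStarRing.norm_star_mul_self (x := 1 - shift a * star (shift a))
    have h2 : star (1 - shift a * star (shift a)) = 1 - shift a * star (shift a) := by simp
    rw [h2, hr.level_zero_mul_self hq1] at h1
    by_contra! h3
    nlinarith
  rw [hr.g_mul_level, norm_smul, norm_pow, Complex.norm_real, Real.norm_eq_abs]
  refine mul_le_of_le_one_right (by positivity) ((norm_mul_le _ _).trans (mul_le_one₀
    ((norm_mul_le _ _).trans (mul_le_one₀ (hr.norm_shift_pow_le hq1 n) (norm_nonneg _)
      ((norm_mul_le _ _).trans (mul_le_one₀ hr.norm_a_le.2 (norm_nonneg _) h0))))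
    (norm_nonneg _) (hr.norm_star_shift_pow_le hq1 n)))

/-- Scalar multiples of `g` on the levels, with coefficients of order `q ^ (-n)`, add up to a
bounded operator. -/
theorem exists_mul_level_eq_smul (hq1 : |q| < 1) (hg : g.ker = ⊥) {c : ℕ → ℂ}
    (hc : ∀ n, ‖c n‖ * |q| ^ n ≤ 1) :
    ∃ D : H →L[ℂ] H, ∀ n, D * level a n = c n • (g * level a n) := by
  refine (hr.isResolution_level hq1 hg).exists_mul_eq (C := 1) (fun n => ?_) (fun n => ?_)
    zero_le_one (fun n => ?_)
  · rw [mul_smul_comm, hr.level_mul_g_mul_level hq1]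
  · rw [smul_mul_assoc, mul_assoc, hr.level_mul_self hq1]
  · rw [norm_smul]
    exact (mul_le_mul_of_nonneg_left (hr.norm_g_mul_level_le hq1 n) (norm_nonneg _)).trans (hc n)

theorem star_mul_level_eq_smul (hq1 : |q| < 1) (hg : g.ker = ⊥) {c : ℕ → ℂ} {D : H →L[ℂ] H}
    (hD : ∀ n, D * level a n = c n • (g * level a n)) (n : ℕ) :
    star D * level a n = star (c n) • (star g * level a n) := by
  rw [(hr.isResolution_level hq1 hg).star_mul_eq (fun n => ?_) hD, star_smul, star_mul, star_level,
    (hr.star_g_commute_level n).eq]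
  rw [mul_smul_comm, hr.level_mul_g_mul_level hq1]

theorem abs_mul_level (hq0 : q ≠ 0) (hq1 : |q| < 1) (n : ℕ) :
    CFC.abs g * level a n = ((|q| ^ n : ℝ) : ℂ) • level a n := by
  refine mul_eq_smul_of_mul_self_mul_eq (CFC.abs_nonneg g) (pow_pos (abs_pos.2 hq0) n) ?_
  rw [CFC.abs_mul_abs, hr.star_g_mul_g_mul_level hq1]
  congr 1
  rw [← Complex.ofReal_pow, ← Complex.ofReal_pow, ← pow_mul, mul_comm n 2, pow_mul, pow_mul, sq_abs]

/-- The phase of `g` and the sign operator of the functional calculus of `g* g`, with their product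
computed on the levels. -/
theorem exists_phase_sign (hq0 : q ≠ 0) (hq1 : |q| < 1) (hg : g.ker = ⊥) :
    ∃ V F : H →L[ℂ] H, IsPhase g V ∧ IsBorelCalculus (star g * g) (signFun q) F ∧
      ∀ n, F * V * level a n = ((q : ℂ) ^ n)⁻¹ • (g * level a n) := by
  have hE := hr.isResolution_level hq1 hg
  have habs : ∀ n, (((|q| ^ n : ℝ) : ℂ)) ≠ 0 := fun n =>
    Complex.ofReal_ne_zero.2 (pow_ne_zero _ (abs_ne_zero.2 hq0))
  obtain ⟨V, hV⟩ := hr.exists_mul_level_eq_smul hq1 hg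
    (c := fun n => (((|q| ^ n : ℝ) : ℂ))⁻¹) (by
      intro n
      rw [norm_inv, Complex.norm_real, Real.norm_of_nonneg (by positivity),
        inv_mul_cancel₀ (pow_ne_zero _ (abs_ne_zero.2 hq0))])
  have hsgn : ∀ n : ℕ, ‖((SignType.sign q : ℝ) : ℂ) ^ n‖ ≤ 1 := by
    intro n
    rw [norm_pow, Complex.norm_real]
    refine pow_le_one₀ (norm_nonneg _) ?_
    rcases lt_or_gt_of_ne hq0 with h | h <;> simp [h]
  obtain ⟨F, hF⟩ := hE.exists_mul_eq (T := fun n => ((SignType.sign q : ℝ) : ℂ) ^ n • level a n)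
    (C := 1) (fun n => by rw [mul_smul_comm, hE.mul_self])
    (fun n => by rw [smul_mul_assoc, hE.mul_self]) zero_le_one (fun n => by
      rw [norm_smul]
      refine mul_le_one₀ (hsgn n) (norm_nonneg _) ?_
      have h1 := CStarRing.norm_star_mul_self (x := level a n)
      rw [star_level, hE.mul_self] at h1
      by_contra! h3
      nlinarith)
  have hVV : star V * V = 1 := by
    refine hE.ext_of_mul_eq fun n => ?_
    rw [mul_assoc, hV, mul_smul_comm, (hr.g_commute_level n).eq, ← mul_assoc,
      hr.star_mul_level_eq_smul hq1 hg hV, smul_mul_assoc, mul_assoc, ← (hr.g_commute_level n).eq,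
      ← mul_assoc, hr.star_g_mul_g_mul_level hq1, smul_smul, smul_smul, one_mul]
    have h1 : (q : ℂ) ^ (2 * n) = ((|q| ^ n : ℝ) : ℂ) * ((|q| ^ n : ℝ) : ℂ) := by
      rw [← Complex.ofReal_mul, ← Complex.ofReal_pow, ← mul_pow, abs_mul_abs_self, ← sq, pow_mul]
    have h2 : star ((((|q| ^ n : ℝ) : ℂ))⁻¹) = (((|q| ^ n : ℝ) : ℂ))⁻¹ := by
      rw [star_inv₀]; congr 1; exact Complex.conj_ofReal _
    rw [h1, h2]
    have := habs n
    field_simp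
    simp
  refine ⟨V, F, ⟨by rw [mul_assoc, hVV, mul_one], ?_, ?_⟩, ?_, fun n => ?_⟩
  · refine hE.ext_of_mul_eq fun n => ?_
    rw [mul_assoc, hr.abs_mul_level hq0 hq1, mul_smul_comm, hV, smul_smul,
      mul_inv_cancel₀ (habs n), one_smul]
  · rw [hg, Submodule.eq_bot_iff]
    intro v hv
    have h1 : (star V * V) v = star V (V v) := rfl
    have h2 : V v = 0 := hv
    rw [hVV, h2, map_zero] at h1
    exact h1
  · have hn : IsStarNormal (star g * g) := (IsSelfAdjoint.star_mul_self g).isStarNormal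
    refine hE.isBorelCalculus (z := fun n => (q : ℂ) ^ (2 * n)) (r := 1) (C := 1) ?_ ?_
      (hr.star_g_mul_g_mul_level hq1) ?_ ?_ ?_
    · intro m n h
      have h1 := congrArg norm h
      simp only [norm_pow, Complex.norm_real, Real.norm_eq_abs] at h1
      have := pow_right_injective₀ (abs_pos.2 hq0) hq1.ne h1
      omega
    · intro n
      rw [norm_pow, Complex.norm_real, Real.norm_eq_abs]
      exact pow_le_one₀ (abs_nonneg q) hq1.le
    · intro n
      rw [star_mul, star_star, hr.star_g_mul_g_mul_level hq1]
      congr 1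
      rw [star_pow]; congr 1; exact (Complex.conj_ofReal q).symm
    · intro n
      rw [signFun_pow hq0 hq1]
      exact hsgn n
    · intro n
      rw [signFun_pow hq0 hq1, hF]
  · rw [mul_assoc, hV, mul_smul_comm, (hr.g_commute_level n).eq, ← mul_assoc, hF, smul_mul_assoc,
      smul_smul, ← Complex.ofReal_pow, ← Complex.ofReal_pow, ← Complex.ofReal_inv,
      ← Complex.ofReal_inv, ← Complex.ofReal_mul]
    congr 2
    rcases lt_or_gt_of_ne hq0 with h | h
    · simp only [sign_neg h, abs_of_neg h]
      rw [neg_pow]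
      rcases neg_one_pow_eq_or ℝ n with h1 | h1 <;> simp [h1]
    · simp [sign_pos h, abs_of_pos h]

end Relations

end Central

/-! ### The center of the generated von Neumann algebra -/

section Center

variable {H : Type*} [NormedAddCommGroup H] [InnerProductSpace ℂ H] [CompleteSpace H]
  {q : ℝ} {a g : H →L[ℂ] H}

namespace Relations

variable (hr : Relations q a g)

include hr

theorem commute_shift {R : H →L[ℂ] H} (ha : Commute R (star a)) (hg : Commute R g)
    (hg' : Commute R (star g)) : Commute R (shift a) :=
  ha.mul_right (hr.commute_rpow (hg'.mul_right hg).symm _).symm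

theorem commute_star_shift {R : H →L[ℂ] H} (ha : Commute R a) (hg : Commute R g)
    (hg' : Commute R (star g)) : Commute R (star (shift a)) := by
  rw [star_shift]
  exact (hr.commute_rpow (hg'.mul_right hg).symm _).symm.mul_right ha

omit hr in
theorem commute_level {R : H →L[ℂ] H} (h1 : Commute R (shift a))
    (h2 : Commute R (star (shift a))) (n : ℕ) : Commute R (level a n) :=
  ((h1.pow_right n).mul_right ((Commute.one_right R).sub_right (h1.mul_right h2))).mul_right
    (h2.pow_right n)

theorem commute_star_a_of_commute_shift (hq1 : |q| < 1) {R : H →L[ℂ] H}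
    (h1 : Commute R (shift a)) (hg : Commute R g) (hg' : Commute R (star g)) :
    Commute R (star a) := by
  rw [hr.star_a_eq hq1]
  exact h1.mul_right (hr.commute_rpow (hg'.mul_right hg).symm _).symm

theorem commute_a_of_commute_star_shift (hq1 : |q| < 1) {R : H →L[ℂ] H}
    (h1 : Commute R (star (shift a))) (hg : Commute R g) (hg' : Commute R (star g)) :
    Commute R a := by
  rw [hr.a_eq hq1]
  exact (hr.commute_rpow (hg'.mul_right hg).symm _).symm.mul_right h1

variable (hq0 : q ≠ 0) (hq1 : |q| < 1) (hgk : g.ker = ⊥) {U : H →L[ℂ] H}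
  (hU : ∀ n, U * level a n = ((q : ℂ) ^ n)⁻¹ • (g * level a n))

include hq0 hq1 hgk hU

omit hq0 in
theorem star_central_mul_level (n : ℕ) :
    star U * level a n = ((q : ℂ) ^ n)⁻¹ • (star g * level a n) := by
  rw [hr.star_mul_level_eq_smul hq1 hgk hU]
  congr 1
  rw [star_inv₀, star_pow]
  congr 2
  exact Complex.conj_ofReal q

omit hq0 in
/-- Everything that commutes with `g`, the isometry and its adjoint commutes with `U`. -/
theorem commute_central {R : H →L[ℂ] H} (h1 : Commute R (shift a))
    (h2 : Commute R (star (shift a))) (hg : Commute R g) : Commute R U := by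
  have hR := commute_level h1 h2
  refine (hr.isResolution_level hq1 hgk).ext_of_mul_eq fun n => ?_
  rw [mul_assoc, hU, mul_assoc, (hR n).eq, ← mul_assoc U, hU, mul_smul_comm, smul_mul_assoc,
    ← mul_assoc, hg.eq, mul_assoc, (hR n).eq, mul_assoc]

theorem central_commute_shift : Commute U (shift a) := by
  refine (hr.isResolution_level hq1 hgk).ext_of_mul_eq fun n => ?_
  have hq : (q : ℂ) ≠ 0 := Complex.ofReal_ne_zero.2 hq0
  rw [mul_assoc, hr.shift_mul_level hq1, ← mul_assoc, hU, smul_mul_assoc, mul_assoc g,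
    ← hr.shift_mul_level hq1, ← mul_assoc, hr.g_mul_shift, smul_mul_assoc, smul_smul, mul_assoc,
    mul_assoc, hU, mul_smul_comm]
  congr 1
  field_simp
  ring

theorem star_central_commute_shift : Commute (star U) (shift a) := by
  refine (hr.isResolution_level hq1 hgk).ext_of_mul_eq fun n => ?_
  have hq : (q : ℂ) ≠ 0 := Complex.ofReal_ne_zero.2 hq0
  have hU' := hr.star_central_mul_level hq1 hgk hU
  rw [mul_assoc, hr.shift_mul_level hq1, ← mul_assoc, hU', smul_mul_assoc, mul_assoc (star g),
    ← hr.shift_mul_level hq1, ← mul_assoc, hr.star_g_mul_shift, smul_mul_assoc, smul_smul,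
    mul_assoc, mul_assoc, hU', mul_smul_comm]
  congr 1
  field_simp
  ring

theorem central_commute_star_shift : Commute U (star (shift a)) := by
  simpa using (hr.star_central_commute_shift hq0 hq1 hgk hU).star_star

omit hq0 in
theorem central_commute_g : Commute U g := by
  refine (hr.isResolution_level hq1 hgk).ext_of_mul_eq fun n => ?_
  rw [mul_assoc, (hr.g_commute_level n).eq, ← mul_assoc, hU, smul_mul_assoc, mul_assoc, mul_assoc,
    hU, mul_smul_comm, (hr.g_commute_level n).eq]

omit hq0 in
theorem central_commute_star_g : Commute U (star g) := by
  refine (hr.isResolution_level hq1 hgk).ext_of_mul_eq fun n => ?_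
  rw [mul_assoc, (hr.star_g_commute_level n).eq, ← mul_assoc, hU, smul_mul_assoc, mul_assoc,
    mul_assoc, hU, mul_smul_comm, ← (hr.star_g_commute_level n).eq, ← mul_assoc, ← mul_assoc,
    hr.normal_g]

/-- An operator `B` on the zeroth level that commutes with `U` and `U*` spreads over all the levels
to an operator that commutes with `g` and the isometry. -/
theorem commute_of_spread {B D : H →L[ℂ] H} (hB' : level a 0 * B = B) (hBU : Commute B U)
    (hD : ∀ n, D * level a n = shift a ^ n * B * star (shift a) ^ n) :
    Commute D (shift a) ∧ Commute D g := by
  have hE := hr.isResolution_level hq1 hgk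
  constructor
  · refine hE.ext_of_mul_eq fun n => ?_
    rw [mul_assoc, hr.shift_mul_level hq1, ← mul_assoc, hD, mul_assoc (shift a), hD]
    simp only [mul_assoc, pow_succ' (shift a), pow_succ (star (shift a)),
      hr.star_shift_mul_shift hq1, mul_one]
  · refine hE.ext_of_mul_eq fun n => ?_
    have hq : (q : ℂ) ^ n ≠ 0 := pow_ne_zero _ (Complex.ofReal_ne_zero.2 hq0)
    have hUs := (hr.central_commute_shift hq0 hq1 hgk hU).pow_right n
    have hUs' := (hr.central_commute_star_shift hq0 hq1 hgk hU).pow_right n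
    have hgE : g * level a n = (q : ℂ) ^ n • (U * level a n) := by
      rw [hU, smul_smul, mul_inv_cancel₀ hq, one_smul]
    have hUE : Commute U (level a n) := commute_level
      (hr.central_commute_shift hq0 hq1 hgk hU) (hr.central_commute_star_shift hq0 hq1 hgk hU) n
    have hBs : (1 - shift a * star (shift a)) * B = B := by
      simpa [level] using hB'
    have hED : level a n * (D * level a n) = D * level a n := by
      rw [hD]
      calc level a n * (shift a ^ n * B * star (shift a) ^ n)
          = shift a ^ n * (1 - shift a * star (shift a)) *
              (star (shift a) ^ n * shift a ^ n) * B * star (shift a) ^ n := by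
            simp only [level, mul_assoc]
        _ = shift a ^ n * ((1 - shift a * star (shift a)) * B) * star (shift a) ^ n := by
            rw [hr.star_shift_pow_mul_shift_pow hq1, mul_one]; simp only [mul_assoc]
        _ = _ := by rw [hBs]
    calc D * g * level a n = (q : ℂ) ^ n • (D * level a n * U) := by
          rw [mul_assoc, hgE, mul_smul_comm, hUE.eq, mul_assoc]
      _ = (q : ℂ) ^ n • (U * (D * level a n)) := by
          congr 1
          rw [hD, mul_assoc, ← hUs'.eq, ← mul_assoc, mul_assoc _ B U, hBU.eq, ← mul_assoc,
            ← hUs.eq]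
          simp only [mul_assoc]
      _ = g * (level a n * (D * level a n)) := by
          rw [← mul_assoc g, hgE, smul_mul_assoc, mul_assoc U, hED]
      _ = g * D * level a n := by rw [hED, mul_assoc]

/-- Let `S` be a *-algebra with the same commutant as `a`, `g` and their adjoints, and let `U` be
the operator `q ^ (-n) g` on the `n`-th level. Then the center of the double commutant of `S` is
generated by `U`. -/
theorem center_centralizer_centralizer (S : StarSubalgebra ℂ (H →L[ℂ] H)) (haS : a ∈ S)
    (hgS : g ∈ S) (hS : ∀ R, Commute R a → Commute R (star a) → Commute R g →
      Commute R (star g) → R ∈ (S : Set (H →L[ℂ] H)).centralizer) :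
    center (S : Set (H →L[ℂ] H)).centralizer.centralizer = (vN {U} : Set (H →L[ℂ] H)) := by
  have hE := hr.isResolution_level hq1 hgk
  have hUs := hr.central_commute_shift hq0 hq1 hgk hU
  have hUs' := hr.central_commute_star_shift hq0 hq1 hgk hU
  have hUg := hr.central_commute_g hq1 hgk hU
  have hUg' := hr.central_commute_star_g hq1 hgk hU
  -- what the elements of the commutant of `S` commute with
  have hcomm : ∀ R ∈ (S : Set (H →L[ℂ] H)).centralizer, Commute R a ∧ Commute R (star a) ∧
      Commute R g ∧ Commute R (star g) := fun R hR =>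
    ⟨(hR a haS).symm, (hR _ (star_mem haS)).symm, (hR g hgS).symm, (hR _ (star_mem hgS)).symm⟩
  have hstar : ∀ R ∈ (S : Set (H →L[ℂ] H)).centralizer,
      star R ∈ (S : Set (H →L[ℂ] H)).centralizer := by
    intro R hR X hX
    simpa using (congrArg star (hR (star X) (star_mem hX))).symm
  have hcs : ∀ R ∈ (S : Set (H →L[ℂ] H)).centralizer,
      Commute R (shift a) ∧ Commute R (star (shift a)) := fun R hR =>
    have h := hcomm R hR
    ⟨hr.commute_shift h.2.1 h.2.2.1 h.2.2.2, hr.commute_star_shift h.1 h.2.2.1 h.2.2.2⟩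
  have hUS' : U ∈ (S : Set (H →L[ℂ] H)).centralizer :=
    hS U (hr.commute_a_of_commute_star_shift hq1 hUs' hUg hUg')
      (hr.commute_star_a_of_commute_shift hq1 hUs hUg hUg') hUg hUg'
  have hcU : ∀ R ∈ (S : Set (H →L[ℂ] H)).centralizer, Commute R U := fun R hR =>
    hr.commute_central hq1 hgk hU (hcs R hR).1 (hcs R hR).2 (hcomm R hR).2.2.1
  have hcU' : ∀ R ∈ (S : Set (H →L[ℂ] H)).centralizer, Commute R (star U) := fun R hR => by
    simpa using (hcU _ (hstar R hR)).star_star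
  have hvN : ∀ T, T ∈ vN {U} ↔ ∀ Z, Commute Z U → Commute Z (star U) → Commute Z T := by
    intro T
    change T ∈ StarSubalgebra.centralizer ℂ
      (StarSubalgebra.centralizer ℂ {U} : Set (H →L[ℂ] H)) ↔ _
    rw [StarSubalgebra.mem_centralizer_iff]
    constructor
    · intro h Z h1 h2
      refine (h Z ?_).1
      rw [SetLike.mem_coe, StarSubalgebra.mem_centralizer_iff]
      rintro _ rfl
      exact ⟨h1.symm, h2.symm⟩
    · intro h Z hZ
      rw [SetLike.mem_coe, StarSubalgebra.mem_centralizer_iff] at hZ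
      have h1 : Commute Z U := (hZ U rfl).1.symm
      have h2 : Commute Z (star U) := (hZ U rfl).2.symm
      exact ⟨h Z h1 h2, h (star Z) (by simpa using h2.star_star) h1.star_star⟩
  ext T
  rw [SetLike.mem_coe, hvN]
  constructor
  · rintro ⟨hT, hTc⟩ R hRU hRU'
    have hTs : Commute T (shift a) := (hTc _ fun X hX => (hcs X hX).1).symm
    have hTs' : Commute T (star (shift a)) := (hTc _ fun X hX => (hcs X hX).2).symm
    have hTE := commute_level hTs hTs'
    have hUE := commute_level hUs hUs'
    have hUE' : Commute (star U) (level a 0) := by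
      simpa [star_level] using (hUE 0).star_star
    have hUs₂ : Commute (star U) (shift a) := by simpa using hUs'.star_star
    have hUs₃ : Commute (star U) (star (shift a)) := hUs.star_star
    -- `T` commutes with every block of `R`, moved to the zeroth level
    have hblock : ∀ i j, Commute T
        (level a 0 * (star (shift a) ^ i * R * shift a ^ j) * level a 0) := by
      intro i j
      -- `B` spreads over the levels to an operator `D` in the commutant of `S`
      set B := level a 0 * (star (shift a) ^ i * R * shift a ^ j) * level a 0 with hBdef
      have hBl : level a 0 * B = B := by
        rw [hBdef, ← mul_assoc, ← mul_assoc, hE.mul_self]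
      have hBr : B * level a 0 = B := by rw [hBdef, mul_assoc, hE.mul_self]
      have hBU : Commute U B := ((hUE 0).mul_right (((hUs'.pow_right i).mul_right
        hRU.symm).mul_right (hUs.pow_right j))).mul_right (hUE 0)
      have hBU' : Commute (star U) B := (hUE'.mul_right (((hUs₃.pow_right i).mul_right
        hRU'.symm).mul_right (hUs₂.pow_right j))).mul_right hUE'
      have hE0 : level a 0 = 1 - shift a * star (shift a) := by simp [level]
      have hl : ∀ n, level a n * (shift a ^ n * B * star (shift a) ^ n) =
          shift a ^ n * B * star (shift a) ^ n := by
        intro n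
        calc level a n * (shift a ^ n * B * star (shift a) ^ n)
            = shift a ^ n * level a 0 * (star (shift a) ^ n * shift a ^ n) * B *
                star (shift a) ^ n := by
              rw [hE0]; simp only [level, mul_assoc]
          _ = shift a ^ n * (level a 0 * B) * star (shift a) ^ n := by
              rw [hr.star_shift_pow_mul_shift_pow hq1, mul_one]; simp only [mul_assoc]
          _ = _ := by rw [hBl]
      have hr' : ∀ n, shift a ^ n * B * star (shift a) ^ n * level a n =
          shift a ^ n * B * star (shift a) ^ n := by
        intro n
        calc shift a ^ n * B * star (shift a) ^ n * level a n
            = shift a ^ n * B * (star (shift a) ^ n * shift a ^ n) * level a 0 *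
                star (shift a) ^ n := by
              rw [hE0]; simp only [level, mul_assoc]
          _ = shift a ^ n * (B * level a 0) * star (shift a) ^ n := by
              rw [hr.star_shift_pow_mul_shift_pow hq1, mul_one]; simp only [mul_assoc]
          _ = _ := by rw [hBr]
      obtain ⟨D, hD⟩ := hE.exists_mul_eq hl hr' (norm_nonneg B) fun n => by
        refine (norm_mul_le _ _).trans ((mul_le_of_le_one_right (norm_nonneg _)
          (hr.norm_star_shift_pow_le hq1 n)).trans ((norm_mul_le _ _).trans
          (mul_le_of_le_one_left (norm_nonneg _) (hr.norm_shift_pow_le hq1 n))))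
      have hD' : ∀ n, star D * level a n = shift a ^ n * star B * star (shift a) ^ n := by
        intro n
        rw [hE.star_mul_eq hl hD]
        simp [mul_assoc]
      have h1 := hr.commute_of_spread hq0 hq1 hgk hU hBl hBU.symm hD
      have h2 := hr.commute_of_spread hq0 hq1 hgk hU (B := star B) (D := star D)
        (by simpa [star_level] using congrArg star hBr) (by simpa using hBU'.symm.star_star) hD'
      have h3 : Commute D (star (shift a)) := by simpa using h2.1.star_star
      have h4 : Commute D (star g) := by simpa using h2.2.star_star
      have hDS : D ∈ (S : Set (H →L[ℂ] H)).centralizer :=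
        hS D (hr.commute_a_of_commute_star_shift hq1 h3 h1.2 h4)
          (hr.commute_star_a_of_commute_shift hq1 h1.1 h1.2 h4) h1.2 h4
      have hTD : Commute T D := (hT D hDS).symm
      have h5 : D * level a 0 = B := by simpa using hD 0
      rw [← h5]
      exact hTD.mul_right (hTE 0)
    have hER : ∀ i j, Commute T (level a i * R * level a j) := by
      intro i j
      have h1 : level a i * R * level a j = shift a ^ i *
          (level a 0 * (star (shift a) ^ i * R * shift a ^ j) * level a 0) *
            star (shift a) ^ j := by
        simp only [level, mul_assoc, pow_zero, one_mul, mul_one]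
      rw [h1]
      exact ((hTs.pow_right i).mul_right (hblock i j)).mul_right (hTs'.pow_right j)
    have hcol : ∀ j, Commute T (R * level a j) := by
      intro j
      rw [commute_iff_eq, ← star_inj]
      refine hE.ext_of_mul_eq fun i => ?_
      rw [← star_inj]
      simp only [star_mul, star_star, star_level]
      rw [← mul_assoc, ← (hTE i).eq, mul_assoc, ← mul_assoc (level a i) R, (hER i j).eq]
      simp only [mul_assoc]
    refine Commute.symm (hE.ext_of_mul_eq fun j => ?_)
    rw [mul_assoc, (hcol j).eq, mul_assoc, mul_assoc, (hTE j).eq]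
  · intro h
    refine ⟨fun X hX => h X (hcU X hX) (hcU' X hX), fun X hX => ?_⟩
    exact h X (hX U hUS').symm (hX _ (hstar U hUS')).symm

end Relations

end Center

/-! ### A representation with a vector annihilated by `α` -/

section Model

/-- The Hilbert space `ℓ²(ℕ)`. -/
abbrev EllTwo : Type := lp (fun _ : ℕ => ℂ) 2

theorem weighted_sum_le {σ : ℕ → ℕ} (hσ : Function.Injective σ) {w : ℕ → ℝ}
    (hw : ∀ n, |w n| ≤ 1) (f : EllTwo) (s : Finset ℕ) :
    ∑ n ∈ s, ‖(w n : ℂ) * f (σ n)‖ ^ (2 : ℝ≥0∞).toReal ≤ ‖f‖ ^ (2 : ℝ≥0∞).toReal := by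
  have h1 : ∀ n, ‖(w n : ℂ) * f (σ n)‖ ^ (2 : ℝ≥0∞).toReal ≤
      ‖f (σ n)‖ ^ (2 : ℝ≥0∞).toReal := by
    intro n
    gcongr
    rw [norm_mul, Complex.norm_real, Real.norm_eq_abs]
    exact mul_le_of_le_one_left (norm_nonneg _) (hw n)
  refine (Finset.sum_le_sum fun n _ => h1 n).trans ?_
  have h2 := lp.sum_rpow_le_norm_rpow (p := 2) (by simp) f (s.image σ)
  rwa [Finset.sum_image fun _ _ _ _ h => hσ h] at h2

/-- The weighted composition operator `f ↦ (n ↦ w n * f (σ n))` on `ℓ²(ℕ)`. -/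
def weighted {σ : ℕ → ℕ} (hσ : Function.Injective σ) {w : ℕ → ℝ} (hw : ∀ n, |w n| ≤ 1) :
    EllTwo →L[ℂ] EllTwo :=
  LinearMap.mkContinuous
    { toFun := fun f => ⟨fun n => (w n : ℂ) * f (σ n), memℓp_gen
        (summable_of_sum_le (fun _ => by positivity) (weighted_sum_le hσ hw f))⟩
      map_add' := fun f g => by ext n; exact mul_add _ _ _
      map_smul' := fun c f => by ext n; exact mul_left_comm _ _ _ } 1 fun f => by
    rw [one_mul]
    exact lp.norm_le_of_forall_sum_le (by simp) (norm_nonneg f) (weighted_sum_le hσ hw f)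

section

variable {σ : ℕ → ℕ} (hσ : Function.Injective σ) {w : ℕ → ℝ} (hw : ∀ n, |w n| ≤ 1)

theorem weighted_apply (f : EllTwo) (n : ℕ) : weighted hσ hw f n = (w n : ℂ) * f (σ n) := rfl

theorem star_weighted_apply_eq_inner (f : EllTwo) (n : ℕ) :
    star (weighted hσ hw) f n = ⟪weighted hσ hw (lp.single 2 n (1 : ℂ)), f⟫_ℂ := by
  rw [← ContinuousLinearMap.adjoint_inner_right, ← ContinuousLinearMap.star_eq_adjoint,
    lp.inner_single_left]
  simp

theorem star_weighted_apply (f : EllTwo) (n : ℕ) :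
    star (weighted hσ hw) f (σ n) = (w n : ℂ) * f n := by
  have h1 : weighted hσ hw (lp.single 2 (σ n) (1 : ℂ)) = lp.single 2 n (w n : ℂ) := by
    ext m
    rw [weighted_apply, lp.single_apply, lp.single_apply]
    by_cases h : m = n
    · subst h; simp
    · rw [Pi.single_eq_of_ne h, Pi.single_eq_of_ne (hσ.ne h), mul_zero]
  rw [star_weighted_apply_eq_inner, h1, lp.inner_single_left]
  simp [mul_comm]

theorem star_weighted_apply_of_notMem (f : EllTwo) {n : ℕ} (hn : n ∉ Set.range σ) :
    star (weighted hσ hw) f n = 0 := by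
  have h1 : weighted hσ hw (lp.single 2 n (1 : ℂ)) = 0 := by
    ext m
    rw [weighted_apply, lp.single_apply, Pi.single_eq_of_ne (fun h => hn ⟨m, h⟩), mul_zero]
    rfl
  rw [star_weighted_apply_eq_inner, h1, inner_zero_left]

end

variable {q : ℝ}

theorem abs_sqrt_one_sub_le (n : ℕ) : |√(1 - q ^ (2 * (n + 1)))| ≤ 1 := by
  rw [abs_of_nonneg (Real.sqrt_nonneg _), Real.sqrt_le_iff]
  have : 0 ≤ q ^ (2 * (n + 1)) := by rw [pow_mul]; positivity
  exact ⟨zero_le_one, by linarith⟩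

theorem abs_pow_le_one (hq1 : |q| < 1) (n : ℕ) : |q ^ n| ≤ 1 := by
  rw [abs_pow]
  exact pow_le_one₀ (abs_nonneg q) hq1.le

/-- The operators `e_n ↦ √(1 - q ^ (2 n)) e_(n-1)` and `e_n ↦ q ^ n e_n` on `ℓ²(ℕ)` satisfy the
relations of `SU_q(2)`. -/
theorem relations_weighted (hq1 : |q| < 1) :
    Relations q (weighted (add_left_injective 1) (abs_sqrt_one_sub_le (q := q)))
      (weighted Function.injective_id (abs_pow_le_one hq1)) := by
  have hsq : ∀ n : ℕ, ((√(1 - q ^ (2 * (n + 1))) : ℝ) : ℂ) * ((√(1 - q ^ (2 * (n + 1))) : ℝ) : ℂ)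
      = 1 - (q : ℂ) ^ (2 * (n + 1)) := by
    intro n
    have h1 : q ^ (2 * (n + 1)) ≤ 1 := by
      rw [pow_mul]
      exact pow_le_one₀ (sq_nonneg q) ((sq_le_one_iff_abs_le_one q).2 hq1.le)
    rw [← Complex.ofReal_mul, Real.mul_self_sqrt (by linarith)]
    push_cast
    rfl
  set A := weighted (add_left_injective 1) (abs_sqrt_one_sub_le (q := q)) with hA
  set G := weighted Function.injective_id (abs_pow_le_one hq1) with hG
  have hAn : ∀ f n, A f n = ((√(1 - q ^ (2 * (n + 1))) : ℝ) : ℂ) * f (n + 1) := fun f n => rfl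
  have hGn : ∀ f n, G f n = (q : ℂ) ^ n * f n := fun f n => by
    rw [hG, weighted_apply]; push_cast; rfl
  have hAs : ∀ f n, star A f (n + 1) = ((√(1 - q ^ (2 * (n + 1))) : ℝ) : ℂ) * f n := fun f n =>
    star_weighted_apply (add_left_injective 1) (abs_sqrt_one_sub_le (q := q)) f n
  have hA0 : ∀ f, star A f 0 = 0 := fun f =>
    star_weighted_apply_of_notMem (add_left_injective 1) (abs_sqrt_one_sub_le (q := q)) f (by simp)
  have hGs : ∀ f n, star G f n = (q : ℂ) ^ n * f n := fun f n => by
    have h := star_weighted_apply Function.injective_id (abs_pow_le_one hq1) f n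
    push_cast at h
    exact h
  constructor
  · ext f n
    change star A (A f) n + star G (G f) n = f n
    rcases n with _ | n
    · rw [hA0, hGs, hGn]; simp
    · rw [hAs, hAn, hGs, hGn, ← mul_assoc, hsq]; ring
  · ext f n
    change A (star A f) n + (q : ℂ) ^ 2 * star G (G f) n = f n
    rw [hAn, hAs, hGs, hGn, ← mul_assoc, hsq]; ring
  · ext f n
    change A (G f) n = (q : ℂ) * G (A f) n
    rw [hAn, hGn, hGn, hAn]; ring
  · ext f n
    change star G (G f) n = G (star G f) n
    rw [hGs, hGn, hGn, hGs]

/-- The vector functional of `e_0` in the representation `relations_weighted`, in which `e_0` is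
annihilated by `α` and fixed by `γ`. -/
theorem exists_functional (hq1 : |q| < 1) : ∃ φ : CSUq q →ₗ[ℂ] ℂ, φ 1 = 1 ∧
    (∀ y, φ (y * alpha q) = 0) ∧ (∀ y, φ (y * gamma q) = φ y) ∧
    (∀ y, φ (star (alpha q) * y) = 0) ∧ (∀ y, φ (star (gamma q) * y) = φ y) := by
  have hnt : Nontrivial EllTwo := ⟨lp.single 2 0 (1 : ℂ), 0, fun h => by
    have h1 := lp.norm_single (E := fun _ : ℕ => ℂ) (p := 2) (by simp) 0 (1 : ℂ)
    rw [h] at h1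
    simp at h1⟩
  obtain ⟨ρ, ⟨hα, hγ⟩, -⟩ := existsUnique_representation (relations_weighted hq1)
  let e : EllTwo := lp.single 2 0 (1 : ℂ)
  have hαe : ρ (alpha q) e = 0 := by
    rw [hα]
    ext n
    rw [weighted_apply, lp.single_apply, Pi.single_eq_of_ne (Nat.succ_ne_zero n), mul_zero]
    rfl
  have hγe : ρ (gamma q) e = e := by
    rw [hγ]
    ext n
    rw [weighted_apply]
    rcases n with _ | n
    · simp
    · simp only [id, e, lp.single_apply]
      rw [Pi.single_eq_of_ne (Nat.succ_ne_zero n), mul_zero]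
  let φ : CSUq q →ₗ[ℂ] ℂ :=
    { toFun := fun y => ⟪e, ρ y e⟫_ℂ
      map_add' := fun x y => by rw [map_add, add_apply, inner_add_right]
      map_smul' := fun c y => by
        rw [map_smul]
        exact inner_smul_right _ _ _ }
  have hφ : ∀ y, φ y = ⟪e, ρ y e⟫_ℂ := fun _ => rfl
  refine ⟨φ, ?_, fun y => ?_, fun y => ?_, fun y => ?_, fun y => ?_⟩
  · rw [hφ, map_one, one_apply_eq_self, lp.inner_single_left]
    simp [e]
  · rw [hφ, map_mul, mul_apply_eq_comp, hαe, map_zero, inner_zero_right]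
  · rw [hφ, map_mul, mul_apply_eq_comp, hγe, hφ]
  · rw [hφ, map_mul, mul_apply_eq_comp, map_star, ContinuousLinearMap.star_eq_adjoint,
      ContinuousLinearMap.adjoint_inner_right, hαe, inner_zero_left]
  · rw [hφ, map_mul, mul_apply_eq_comp, map_star, ContinuousLinearMap.star_eq_adjoint,
      ContinuousLinearMap.adjoint_inner_right, hγe, hφ]

end Model

/-! ### The Haar state on the powers of `α` -/

section Haar

variable {q : ℝ}

theorem relations_alpha_gamma (q : ℝ) : Relations q (alpha q) (gamma q) where
  star_a_mul_a := Subtype.ext (lp.ext (funext fun r => r.rel.star_a_mul_a))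
  a_mul_star_a := Subtype.ext (lp.ext (funext fun r => r.rel.a_mul_star_a))
  a_mul_g := Subtype.ext (lp.ext (funext fun r => r.rel.a_mul_g))
  normal_g := Subtype.ext (lp.ext (funext fun r => r.rel.normal_g))

theorem Relations.map {A B : Type*} [Ring A] [StarRing A] [Algebra ℂ A] [Ring B] [StarRing B]
    [Algebra ℂ B] {a g : A} (h : Relations q a g) (π : A →⋆ₐ[ℂ] B) : Relations q (π a) (π g) where
  star_a_mul_a := by
    simpa only [map_add, map_mul, map_star, map_smul, map_one] using congrArg π h.star_a_mul_a
  a_mul_star_a := by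
    simpa only [map_add, map_mul, map_star, map_smul, map_one] using congrArg π h.a_mul_star_a
  a_mul_g := by
    simpa only [map_add, map_mul, map_star, map_smul, map_one] using congrArg π h.a_mul_g
  normal_g := by
    simpa only [map_add, map_mul, map_star, map_smul, map_one] using congrArg π h.normal_g

/-- A closed property that holds for the generators and their adjoints and is stable under the
algebra operations holds on all of `C(SU_q(2))`. -/
theorem CSUq.induction {p : CSUq q → Prop} (hclosed : IsClosed {y | p y})
    (hα : p (alpha q)) (hγ : p (gamma q)) (hc : ∀ c : ℂ, p (algebraMap ℂ (CSUq q) c))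
    (hadd : ∀ x y, p x → p y → p (x + y)) (hmul : ∀ x y, p x → p y → p (x * y))
    (hstar : ∀ x, p x → p (star x)) (y : CSUq q) : p y := by
  have hS : ∀ (x : BigProd q) (hx : x ∈ StarAlgebra.adjoin ℂ {bigA q, bigG q}),
      p (⟨x, StarSubalgebra.le_topologicalClosure _ hx⟩ : univSubalgebra q) := by
    intro x hx
    induction hx using StarAlgebra.adjoin_induction with
    | mem x hx =>
      rcases hx with rfl | rfl
      · exact hα
      · exact hγ
    | algebraMap c => exact hc c
    | add x y hx hy h3 h4 =>
      let X : CSUq q := ⟨x, StarSubalgebra.le_topologicalClosure _ hx⟩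
      let Y : CSUq q := ⟨y, StarSubalgebra.le_topologicalClosure _ hy⟩
      exact hadd X Y h3 h4
    | mul x y hx hy h3 h4 =>
      let X : CSUq q := ⟨x, StarSubalgebra.le_topologicalClosure _ hx⟩
      let Y : CSUq q := ⟨y, StarSubalgebra.le_topologicalClosure _ hy⟩
      exact hmul X Y h3 h4
    | star x hx h3 =>
      let X : CSUq q := ⟨x, StarSubalgebra.le_topologicalClosure _ hx⟩
      exact hstar X h3
  obtain ⟨y, hy⟩ := y
  obtain ⟨u, hu, hlim⟩ := mem_closure_iff_seq_limit.1 hy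
  have hlim' : Filter.Tendsto
      (fun n => (⟨u n, StarSubalgebra.le_topologicalClosure _ (hu n)⟩ : univSubalgebra q))
      Filter.atTop (nhds (⟨y, hy⟩ : univSubalgebra q)) := tendsto_subtype_rng.2 hlim
  exact hclosed.mem_of_tendsto hlim' (Filter.Eventually.of_forall fun n => hS _ (hu n))

/-- The comultiplication of `α`. -/
def comulAlpha (q : ℝ) : CSUq q ⊗[ℂ] CSUq q :=
  alpha q ⊗ₜ[ℂ] alpha q - (q : ℂ) • (star (gamma q) ⊗ₜ[ℂ] gamma q)

theorem slice_mul_comulAlpha {φ : CSUq q →ₗ[ℂ] ℂ} (h1 : ∀ y, φ (y * alpha q) = 0)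
    (h2 : ∀ y, φ (y * gamma q) = φ y) (Y : CSUq q ⊗[ℂ] CSUq q) (d : CSUq q) :
    sliceRight φ (Y * comulAlpha q * d ⊗ₜ[ℂ] 1) =
      sliceRight φ (Y * (-(q : ℂ) • (star (gamma q) * d)) ⊗ₜ[ℂ] 1) := by
  induction Y with
  | zero => simp
  | add x y hx hy => rw [add_mul, add_mul, add_mul, map_add, map_add, hx, hy]
  | tmul x y =>
    simp [comulAlpha, sliceRight, mul_sub, sub_mul, TensorProduct.smul_tmul', h1, h2, mul_assoc]

theorem slice_star_comulAlpha_mul {φ : CSUq q →ₗ[ℂ] ℂ} (h1 : ∀ y, φ (star (alpha q) * y) = 0)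
    (h2 : ∀ y, φ (star (gamma q) * y) = φ y) (Y : CSUq q ⊗[ℂ] CSUq q) (c : CSUq q) :
    sliceRight φ (c ⊗ₜ[ℂ] 1 * star (comulAlpha q) * Y) =
      sliceRight φ ((-(q : ℂ) • (c * gamma q)) ⊗ₜ[ℂ] 1 * Y) := by
  induction Y with
  | zero => simp
  | add x y hx hy => rw [mul_add, mul_add, map_add, map_add, hx, hy]
  | tmul x y =>
    simp [comulAlpha, sliceRight, mul_sub, sub_mul, TensorProduct.smul_tmul', h1, h2, mul_assoc]

theorem slice_mul_comulAlpha_pow {φ : CSUq q →ₗ[ℂ] ℂ} (h1 : ∀ y, φ (y * alpha q) = 0)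
    (h2 : ∀ y, φ (y * gamma q) = φ y) (n : ℕ) (Y : CSUq q ⊗[ℂ] CSUq q) (d : CSUq q) :
    sliceRight φ (Y * comulAlpha q ^ n * d ⊗ₜ[ℂ] 1) =
      sliceRight φ (Y * ((-(q : ℂ)) ^ n • (star (gamma q) ^ n * d)) ⊗ₜ[ℂ] 1) := by
  induction n generalizing d with
  | zero => simp
  | succ n ih =>
    rw [pow_succ, ← mul_assoc, slice_mul_comulAlpha h1 h2, ih]
    congr 3
    rw [mul_smul_comm, smul_smul, pow_succ, pow_succ (star (gamma q)), mul_assoc]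

theorem slice_star_comulAlpha_pow_mul {φ : CSUq q →ₗ[ℂ] ℂ}
    (h1 : ∀ y, φ (star (alpha q) * y) = 0) (h2 : ∀ y, φ (star (gamma q) * y) = φ y) (n : ℕ)
    (Y : CSUq q ⊗[ℂ] CSUq q) (c : CSUq q) :
    sliceRight φ (c ⊗ₜ[ℂ] 1 * star (comulAlpha q) ^ n * Y) =
      sliceRight φ (((-(q : ℂ)) ^ n • (c * gamma q ^ n)) ⊗ₜ[ℂ] 1 * Y) := by
  induction n generalizing c with
  | zero => simp
  | succ n ih =>
    rw [pow_succ', ← mul_assoc, mul_assoc (_ * _), slice_star_comulAlpha_mul h1 h2, ← mul_assoc, ih]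
    congr 3
    rw [smul_mul_assoc, smul_smul, pow_succ, pow_succ' (gamma q), mul_assoc]

theorem apply_sliceRight {A : Type*} [Ring A] [Algebra ℂ A] (h φ : A →ₗ[ℂ] ℂ) (Y : A ⊗[ℂ] A) :
    h (sliceRight φ Y) = φ (sliceLeft h Y) := by
  induction Y with
  | zero => simp
  | add x y hx hy => simp only [map_add, hx, hy]
  | tmul x y => simp [sliceRight, sliceLeft, mul_comm]

/-- Slicing `Δ(α* ^ n α ^ n)` by the functional that kills `α` and sends `γ` to `1` leaves
`q ^ (2 n) γ ^ n γ* ^ n`. By invariance this computes the Haar state. -/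
theorem IsHaarState.apply_star_alpha_pow_mul {h : CSUq q →ₚ[ℂ] ℂ} (hh : IsHaarState h)
    (hq1 : |q| < 1) (n : ℕ) : h (star (alpha q ^ n) * alpha q ^ n) =
      (q : ℂ) ^ (2 * n) * h (gamma q ^ n * star (gamma q) ^ n) := by
  obtain ⟨φ, hφ1, h1, h2, h3, h4⟩ := exists_functional hq1
  have hmem : (alpha q, comulAlpha q) ∈ comulGraph q :=
    StarAlgebra.subset_adjoin ℂ _ (Set.mem_insert _ _)
  have hinv := hh.left_invariant _ (mul_mem (star_mem (pow_mem hmem n)) (pow_mem hmem n))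
  have hs := apply_sliceRight h.toLinearMap φ (star (comulAlpha q ^ n) * comulAlpha q ^ n)
  have hinv' : sliceLeft h.toLinearMap (star (comulAlpha q ^ n) * comulAlpha q ^ n) =
      h (star (alpha q ^ n) * alpha q ^ n) • (1 : CSUq q) := hinv
  rw [hinv', map_smul, hφ1, smul_eq_mul, mul_one] at hs
  rw [← hs]
  have h5 : star (comulAlpha q ^ n) * comulAlpha q ^ n =
      (1 : CSUq q) ⊗ₜ[ℂ] (1 : CSUq q) * star (comulAlpha q) ^ n *
        (comulAlpha q ^ n * (1 : CSUq q) ⊗ₜ[ℂ] (1 : CSUq q)) := by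
    rw [← Algebra.TensorProduct.one_def, one_mul, mul_one, star_pow]
  rw [h5, slice_star_comulAlpha_pow_mul h3 h4, ← mul_assoc, slice_mul_comulAlpha_pow h1 h2]
  have h6 : sliceRight φ (((-(q : ℂ)) ^ n • (1 * gamma q ^ n)) ⊗ₜ[ℂ] 1 *
      ((-(q : ℂ)) ^ n • (star (gamma q) ^ n * 1)) ⊗ₜ[ℂ] 1) =
      (q : ℂ) ^ (2 * n) • (gamma q ^ n * star (gamma q) ^ n) := by
    rw [Algebra.TensorProduct.tmul_mul_tmul]
    simp only [one_mul, mul_one, sliceRight, LinearMap.comp_apply, LinearMap.lTensor_tmul, hφ1,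
      LinearEquiv.coe_coe, TensorProduct.rid_tmul,
      smul_mul_assoc, mul_smul_comm, smul_smul]
    congr 1
    rw [← mul_pow, neg_mul_neg, ← sq, ← pow_mul]
  rw [h6]
  exact map_smul h.toLinearMap _ _

end Haar

/-! ### Injectivity of `γ` in the GNS representation of the Haar state -/

section GNS

variable {q : ℝ} (h : CSUq q →ₚ[ℂ] ℂ)

/-- The cyclic vector of the GNS representation. -/
def cyclicVector : h.GNS := ((h.toPreGNS 1 : h.PreGNS) : h.GNS)

theorem gns_apply_cyclicVector (y : CSUq q) :
    h.gnsStarAlgHom y (cyclicVector h) = ((h.toPreGNS y : h.PreGNS) : h.GNS) := by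
  change h.gnsNonUnitalStarAlgHom y ((h.toPreGNS 1 : h.PreGNS) : h.GNS) = _
  rw [PositiveLinearMap.gnsNonUnitalStarAlgHom_apply_coe,
    PositiveLinearMap.leftMulMapPreGNS_apply]
  simp

theorem norm_gns_apply_cyclicVector_sq (y : CSUq q) :
    ((‖h.gnsStarAlgHom y (cyclicVector h)‖ : ℝ) : ℂ) ^ 2 = h (star y * y) := by
  rw [gns_apply_cyclicVector, UniformSpace.Completion.norm_coe, PositiveLinearMap.preGNS_norm_sq]
  simp

theorem eq_zero_of_inner_gns_apply {v : h.GNS}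
    (hv : ∀ y, ⟪h.gnsStarAlgHom y (cyclicVector h), v⟫_ℂ = 0) : v = 0 := by
  have hd : DenseRange fun y : CSUq q => h.gnsStarAlgHom y (cyclicVector h) := by
    have h1 := UniformSpace.Completion.denseRange_coe (α := h.PreGNS)
    simp only [gns_apply_cyclicVector]
    exact h1
  have hcl : IsClosed {w : h.GNS | ⟪w, v⟫_ℂ = 0} :=
    isClosed_eq (continuous_id.inner continuous_const) continuous_const
  have h2 : ∀ w : h.GNS, ⟪w, v⟫_ℂ = 0 := fun w =>
    closure_minimal (by rintro _ ⟨y, rfl⟩; exact hv y) hcl (hd w)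
  exact inner_self_eq_zero.1 (h2 v)

theorem relations_gns : Relations q (h.gnsStarAlgHom (alpha q)) (h.gnsStarAlgHom (gamma q)) :=
  (relations_alpha_gamma q).map h.gnsStarAlgHom

variable {h}

/-- The powers of `α` tend to zero on the cyclic vector. -/
theorem IsHaarState.norm_alpha_pow_apply_le (hh : IsHaarState h) (hq1 : |q| < 1) (n : ℕ) :
    ‖(h.gnsStarAlgHom (alpha q) ^ n) (cyclicVector h)‖ ≤ |q| ^ n := by
  have h1 := norm_gns_apply_cyclicVector_sq h (alpha q ^ n)
  have h2 := norm_gns_apply_cyclicVector_sq h (star (gamma q) ^ n)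
  have h3 := norm_gns_apply_cyclicVector_sq h 1
  rw [hh.apply_star_alpha_pow_mul hq1] at h1
  rw [star_pow, star_star] at h2
  rw [star_one, one_mul, hh.map_one, _root_.map_one, one_apply_eq_self] at h3
  rw [← h2, map_pow, map_pow, map_star] at h1
  have h4 : ‖cyclicVector h‖ = 1 := by
    have h5 : ‖cyclicVector h‖ ^ 2 = 1 := by exact_mod_cast h3
    exact (pow_eq_one_iff_of_nonneg (norm_nonneg _) two_ne_zero).1 h5
  have h5 : ‖(star (h.gnsStarAlgHom (gamma q)) ^ n) (cyclicVector h)‖ ≤ 1 := by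
    have := ContinuousLinearMap.le_of_opNorm_le _
      ((relations_gns h).norm_star_g_pow_le n) (cyclicVector h)
    rwa [h4, mul_one] at this
  have h6 : ‖(h.gnsStarAlgHom (alpha q) ^ n) (cyclicVector h)‖ ^ 2 =
      (|q| ^ n) ^ 2 * ‖(star (h.gnsStarAlgHom (gamma q)) ^ n) (cyclicVector h)‖ ^ 2 := by
    rw [← pow_mul, mul_comm n 2, pow_mul |q|, sq_abs, ← pow_mul]
    exact_mod_cast h1
  refine abs_le_of_sq_le_sq' ?_ (by positivity) |>.2
  rw [h6]
  exact mul_le_of_le_one_right (by positivity) (pow_le_one₀ (norm_nonneg _) h5)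

/-- `π_h(γ)` is injective. On its kernel `α` is unitary, so that the kernel is orthogonal to the
cyclic vector; as the kernel is invariant, it is orthogonal to everything. -/
theorem IsHaarState.ker_gamma (hh : IsHaarState h) (hq0 : q ≠ 0) (hq1 : |q| < 1) :
    (h.gnsStarAlgHom (gamma q)).ker = ⊥ := by
  have hr := relations_gns h
  set a := h.gnsStarAlgHom (alpha q) with ha
  set g := h.gnsStarAlgHom (gamma q) with hg
  have hq : (q : ℂ) ≠ 0 := Complex.ofReal_ne_zero.2 hq0
  have happ : ∀ {A B : h.GNS →L[ℂ] h.GNS} (_ : A = B) (v : h.GNS), A v = B v := by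
    rintro A _ rfl v; rfl
  have hga : ∀ v, g v = 0 → g (a v) = 0 := by
    intro v hv
    have h1 : a (g v) = (q : ℂ) • g (a v) := happ hr.a_mul_g v
    rw [hv, map_zero] at h1
    exact (smul_eq_zero.1 h1.symm).resolve_left hq
  have hga' : ∀ v, g v = 0 → g (star a v) = 0 := by
    intro v hv
    have h1 : g (star a v) = (q : ℂ) • star a (g v) := happ hr.g_mul_star_a v
    rw [h1, hv, map_zero, smul_zero]
  have hgg : ∀ v, g v = 0 → g (star g v) = 0 := by
    intro v hv
    have h1 : star g (g v) = g (star g v) := happ hr.normal_g v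
    rw [← h1, hv, map_zero]
  have hgpow : ∀ n v, g v = 0 → g ((a ^ n) v) = 0 := by
    intro n
    induction n with
    | zero => exact fun v hv => hv
    | succ n ih => intro v hv; rw [pow_succ]; exact ih _ (hga v hv)
  have hiso : ∀ n v, g v = 0 → (star a ^ n) ((a ^ n) v) = v := by
    intro n
    induction n with
    | zero => exact fun v _ => rfl
    | succ n ih =>
      intro v hv
      have h1 : star a (a ((a ^ n) v)) + star g (g ((a ^ n) v)) = (a ^ n) v :=
        happ hr.star_a_mul_a _
      rw [hgpow n v hv, map_zero, add_zero] at h1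
      rw [pow_succ, pow_succ']
      change (star a ^ n) (star a (a ((a ^ n) v))) = v
      rw [h1, ih v hv]
  have horth : ∀ v, g v = 0 → ⟪cyclicVector h, v⟫_ℂ = 0 := by
    intro v hv
    have hle : ∀ n : ℕ, ‖⟪cyclicVector h, v⟫_ℂ‖ ≤ |q| ^ n * ‖v‖ := by
      intro n
      have h1 : ⟪cyclicVector h, v⟫_ℂ = ⟪(a ^ n) (cyclicVector h), (a ^ n) v⟫_ℂ := by
        conv_lhs => rw [← hiso n v hv]
        rw [← star_pow, ContinuousLinearMap.star_eq_adjoint,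
          ContinuousLinearMap.adjoint_inner_right]
      have h2 : ‖(a ^ n) v‖ = ‖v‖ := by
        have h3 : ⟪(a ^ n) v, (a ^ n) v⟫_ℂ = ⟪v, v⟫_ℂ := by
          conv_rhs => rw [← hiso n v hv]
          rw [← star_pow, ContinuousLinearMap.star_eq_adjoint,
            ContinuousLinearMap.adjoint_inner_right, ← ContinuousLinearMap.star_eq_adjoint,
            star_pow, hiso n v hv]
        rw [norm_eq_sqrt_re_inner (𝕜 := ℂ), h3, ← norm_eq_sqrt_re_inner]
      rw [h1]
      refine (norm_inner_le_norm _ _).trans ?_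
      rw [h2]
      gcongr
      exact hh.norm_alpha_pow_apply_le hq1 n
    have hlim : Filter.Tendsto (fun n => |q| ^ n * ‖v‖) Filter.atTop (nhds 0) := by
      simpa using (tendsto_pow_atTop_nhds_zero_of_lt_one (abs_nonneg q) hq1).mul_const ‖v‖
    exact norm_le_zero_iff.1 (ge_of_tendsto' hlim hle)
  have hinv : ∀ y : CSUq q, ∀ v, g v = 0 →
      g (h.gnsStarAlgHom y v) = 0 ∧ g (star (h.gnsStarAlgHom y) v) = 0 := by
    intro y
    have hcont : Continuous h.gnsStarAlgHom := map_continuous _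
    induction y using CSUq.induction with
    | hclosed =>
      simp only [Set.ofPred_forall]
      refine isClosed_iInter fun v => isClosed_iInter fun _ => IsClosed.inter
        (isClosed_eq ?_ continuous_const) (isClosed_eq ?_ continuous_const)
      · exact g.continuous.comp ((ContinuousLinearMap.apply ℂ h.GNS v).continuous.comp hcont)
      · exact g.continuous.comp
          ((ContinuousLinearMap.apply ℂ h.GNS v).continuous.comp (continuous_star.comp hcont))
    | hα => exact fun v hv => ⟨hga v hv, hga' v hv⟩
    | hγ => exact fun v hv => ⟨(congrArg g hv).trans (map_zero g), hgg v hv⟩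
    | hc c =>
      intro v hv
      rw [← map_star, ← algebraMap_star_comm, AlgHomClass.commutes, AlgHomClass.commutes]
      simp [Algebra.algebraMap_eq_smul_one, hv]
    | hadd x y hx hy =>
      intro v hv
      rw [map_add, star_add, add_apply, add_apply, map_add, map_add, (hx v hv).1, (hx v hv).2,
        (hy v hv).1, (hy v hv).2]
      simp
    | hmul x y hx hy =>
      intro v hv
      rw [map_mul, star_mul]
      exact ⟨(hx _ (hy v hv).1).1, (hy _ (hx v hv).2).2⟩
    | hstar x hx =>
      intro v hv
      rw [map_star, star_star]
      exact (hx v hv).symm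
  rw [Submodule.eq_bot_iff]
  intro v hv
  refine eq_zero_of_inner_gns_apply h fun y => ?_
  rw [← ContinuousLinearMap.adjoint_inner_right, ← ContinuousLinearMap.star_eq_adjoint]
  exact horth _ (hinv y v hv).2

variable (h)

/-- Operators that commute with `π_h(α)`, `π_h(γ)` and their adjoints lie in the commutant. -/
theorem mem_centralizer_range {R : h.GNS →L[ℂ] h.GNS}
    (ha : Commute R (h.gnsStarAlgHom (alpha q))) (ha' : Commute R (star (h.gnsStarAlgHom (alpha q))))
    (hg : Commute R (h.gnsStarAlgHom (gamma q)))
    (hg' : Commute R (star (h.gnsStarAlgHom (gamma q)))) :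
    R ∈ (Set.range h.gnsStarAlgHom).centralizer := by
  have hcont : Continuous h.gnsStarAlgHom := map_continuous _
  have key : ∀ y, Commute R (h.gnsStarAlgHom y) ∧ Commute R (star (h.gnsStarAlgHom y)) := by
    intro y
    induction y using CSUq.induction with
    | hclosed =>
      refine IsClosed.inter (isClosed_eq ?_ ?_) (isClosed_eq ?_ ?_)
      · exact continuous_const.mul hcont
      · exact hcont.mul continuous_const
      · exact continuous_const.mul (continuous_star.comp hcont)
      · exact (continuous_star.comp hcont).mul continuous_const
    | hα => exact ⟨ha, ha'⟩
    | hγ => exact ⟨hg, hg'⟩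
    | hc c =>
      rw [← map_star, ← algebraMap_star_comm, AlgHomClass.commutes, AlgHomClass.commutes]
      exact ⟨Algebra.commute_algebraMap_right _ _, Algebra.commute_algebraMap_right _ _⟩
    | hadd x y hx hy =>
      rw [map_add, star_add]
      exact ⟨hx.1.add_right hy.1, hx.2.add_right hy.2⟩
    | hmul x y hx hy =>
      rw [map_mul, star_mul]
      exact ⟨hx.1.mul_right hy.1, hy.2.mul_right hx.2⟩
    | hstar x hx =>
      rw [map_star, star_star]
      exact hx.symm
  rintro _ ⟨y, rfl⟩
  exact (key y).1.symm

end GNS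

end SUq

end

theorem theorem6p2 (q : ℝ) (hq0 : q ≠ 0) (hq1 : |q| < 1)
    (h : SUq.CSUq q →ₚ[ℂ] ℂ) (hh : SUq.IsHaarState h) :
    (∃ L : VonNeumannAlgebra h.GNS, (L : Set (h.GNS →L[ℂ] h.GNS)) = SUq.Linf h) ∧
    ∃ V F : h.GNS →L[ℂ] h.GNS,
      SUq.IsPhase (h.gnsStarAlgHom (SUq.gamma q)) V ∧
      SUq.IsBorelCalculus (h.gnsStarAlgHom (star (SUq.gamma q) * SUq.gamma q))
        (SUq.signFun q) F ∧
      SUq.center (SUq.Linf h) = (SUq.vN {F * V} : Set (h.GNS →L[ℂ] h.GNS)) := by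
  have hr := SUq.relations_gns h
  have hker := hh.ker_gamma hq0 hq1
  have hS : (h.gnsStarAlgHom.range : Set (h.GNS →L[ℂ] h.GNS)) = Set.range h.gnsStarAlgHom := rfl
  have hLinf : SUq.Linf h =
      (h.gnsStarAlgHom.range : Set (h.GNS →L[ℂ] h.GNS)).centralizer.centralizer := by
    rw [SUq.Linf, ← hS, SUq.strongClosure_eq_centralizer_centralizer]
  refine ⟨⟨SUq.vN (h.gnsStarAlgHom.range : Set (h.GNS →L[ℂ] h.GNS)), ?_⟩, ?_⟩
  · rw [hLinf]
    refine (StarSubalgebra.coe_centralizer_centralizer ℂ _).trans ?_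
    rw [Set.union_eq_self_of_subset_right]
    intro x hx
    simpa using star_mem (s := h.gnsStarAlgHom.range) hx
  · obtain ⟨V, F, hV, hF, hU⟩ := hr.exists_phase_sign hq0 hq1 hker
    refine ⟨V, F, hV, by rw [map_mul, map_star]; exact hF, ?_⟩
    rw [hLinf]
    refine hr.center_centralizer_centralizer hq0 hq1 hker hU _ ⟨_, rfl⟩ ⟨_, rfl⟩ ?_
    intro R ha ha' hg hg'
    rw [hS]
    exact SUq.mem_centralizer_range h ha ha' hg hg'
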